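/- **Setting.** A *superform* on $\mathbb R^n$ is a form $a=\sum_{I,J}a_{IJ}(x)\,dx_I\wedge d\xi_J$ on $\mathbb R^n_x\oplus\mathbb R^n_\xi$ whose coefficients depend only on $x$; put $da=\sum_k dx_k\wedge\partial a/\partial x_k$, let $J$ (also written $a^\#=J(a)$) be the multiplicative map with $J(dx_i)=d\xi_i$, $J(d\xi_i)=-dx_i$, and let $\beta=\sum_i dx_i\wedge d\xi_i$. For an open set $\Omega\subseteq\mathbb R^n$, a *supercurrent* on $\Omega$ is a continuous linear functional on the smooth superforms with compact support in $\Omega$; put $(T\wedge\alpha).\varphi=T.(\alpha\wedge\varphi)$ and $dT.\varphi=(-1)^{k+1}\,T.d\varphi$ if $T$ has total degree $k$. Let $1\le m\le n$, $p=n-m$, and let $M$ be a smooth embedded $m$-dimensional submanifold of $\Omega$ (without boundary) which is closed as a subset of $\Omega$; for instance $\Omega=\mathbb R^n$ and $M$ a closed submanifold of $\mathbb R^n$. Its supercurrent is $$[M]_s=c_p\,\nu\wedge \nu^\#\,{*dS_M},\qquad [M]_s.\varphi=\int_M\langle c_p\,\nu\wedge \nu^\#\wedge\varphi\rangle\,dS_M,$$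 where $\nu=n_1\wedge\dots\wedge n_p$ for any orthonormal basis $n_1,\dots,n_p$ of the conormal space of $M$ at the point, $c_p=(-1)^{p(p-1)/2}$, $dS_M$ is the $m$-dimensional surface measure of $M$, and $\langle a\rangle$ is the coefficient of $dx_1\wedge d\xi_1\wedge\dots\wedge dx_n\wedge d\xi_n$ in $a$. Locally let $\rho_1,\dots,\rho_p$ be smooth defining functions of $M$ whose differentials $n_j=d\rho_j$ are orthonormal on $M$, and let $H_j$ be the trace over $TM$ of the $(1,1)$-form $F_j=dn_j^\#=\sum_{k,l}\frac{\partial^2\rho_j}{\partial x_k\partial x_l}dx_k\wedge d\xi_l$. The *mean curvature vector* of $M$ is $\vec H=\sum_jH_j\vec n_j$, and $M$ is *minimal* if $\vec H=0$ at every point of $M$. **Corollary 5.2.** The supercurrent $[M]_s\wedge\beta^{m-1}$ on $\Omega$ is closed, i.e. $d([M]_s\wedge\beta^{m-1})=0$, if and only if $M$ is minimal. -/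

import Mathlib

open scoped ContDiff Distributions Gradient MeasureTheory

noncomputable section

namespace Super

/-! ### The superalgebra -/

/-- Euclidean space `ℝⁿ`. -/
abbrev E (n : ℕ) : Type := EuclideanSpace ℝ (Fin n)

/-- Constant covectors on the superspace `ℝⁿ ⊕ ℝⁿ`, in coordinates. The index `(i, 0)` stands for
`dx_i` and `(i, 1)` for `dξ_i`; the lexicographic order is `x₁, ξ₁, x₂, ξ₂, …`. -/
abbrev Covector (n : ℕ) : Type := (Fin n ×ₗ Fin 2) → ℝ

/-- Constant-coefficient superforms: the exterior algebra on `dx₁, dξ₁, …, dx_n, dξ_n`.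
The wedge product is the product of this algebra. -/
abbrev Form (n : ℕ) : Type := ExteriorAlgebra ℝ (Covector n)

/-- The basis of monomials in `dx₁, dξ₁, dx₂, dξ₂, …` (written in this order), indexed by finite
sets of indices. -/
def monomials (n : ℕ) : Module.Basis (Finset (Fin n ×ₗ Fin 2)) ℝ (Form n) :=
  (Pi.basisFun ℝ (Fin n ×ₗ Fin 2)).ExteriorAlgebra

/-- The (finite-dimensional) space of forms is normed by the largest absolute value of a
coefficient; only the resulting topology matters. -/
instance formNormedAddCommGroup (n : ℕ) : NormedAddCommGroup (Form n) :=
  NormedAddCommGroup.induced (Form n) (Finset (Fin n ×ₗ Fin 2) → ℝ)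
    (monomials n).equivFun.toLinearMap (monomials n).equivFun.injective

instance formNormedSpace (n : ℕ) : NormedSpace ℝ (Form n) :=
  NormedSpace.induced ℝ (Form n) (Finset (Fin n ×ₗ Fin 2) → ℝ)
    (monomials n).equivFun.toLinearMap

instance formFiniteDimensional (n : ℕ) : FiniteDimensional ℝ (Form n) :=
  (monomials n).finiteDimensional_of_finite

/-- `dx_i`. -/
def dx {n : ℕ} (i : Fin n) : Form n := ExteriorAlgebra.ι ℝ (Pi.single (toLex (i, 0)) 1)

/-- `dξ_i`. -/
def dxi {n : ℕ} (i : Fin n) : Form n := ExteriorAlgebra.ι ℝ (Pi.single (toLex (i, 1)) 1)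

/-- The complex structure on covectors: `J (dx_i) = dξ_i`, `J (dξ_i) = -dx_i`. -/
def covectorJ (n : ℕ) : Covector n →ₗ[ℝ] Covector n where
  toFun a k := if (ofLex k).2 = 0 then -a (toLex ((ofLex k).1, 1)) else a (toLex ((ofLex k).1, 0))
  map_add' a b := by
    funext k
    by_cases h : (ofLex k).2 = 0
    · simp [h]; ring
    · simp [h]
  map_smul' c a := by
    funext k
    by_cases h : (ofLex k).2 = 0 <;> simp [h]

/-- `J` extended multiplicatively to all forms; `J a` is also written `a^#` for `a` of bidegree
`(p, 0)`. -/
def J (n : ℕ) : Form n →ₐ[ℝ] Form n := ExteriorAlgebra.map (covectorJ n)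

/-- The sign automorphism: multiplication by `(-1)^k` on forms of total degree `k`. -/
def degreeSign (n : ℕ) : Form n →ₐ[ℝ] Form n :=
  ExteriorAlgebra.map (-(LinearMap.id : Covector n →ₗ[ℝ] Covector n))

/-- The coefficient `a₀` of `a = a₀ dx₁ ∧ dξ₁ ∧ … ∧ dx_n ∧ dξ_n + (other monomials)`: the
normalised Berezin integral, so that the superintegral of a superform `a` over `ℝⁿ` is
`∫ topCoeff (a x) dx`. -/
def topCoeff (n : ℕ) : Form n →ₗ[ℝ] ℝ := (monomials n).coord Finset.univ

/-- The Euclidean Kähler form `β = ∑ dx_i ∧ dξ_i`. -/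
def beta (n : ℕ) : Form n := ∑ i : Fin n, dx i * dxi i

/-- Wedge product with a fixed form on the left, as a continuous linear map. -/
def wedgeLeft {n : ℕ} (a : Form n) : Form n →L[ℝ] Form n :=
  LinearMap.toContinuousLinearMap (LinearMap.mulLeft ℝ a)

/-- The continuous bilinear pairing `(a, b) ↦ topCoeff (b ∧ a)`. -/
def pairing (n : ℕ) : Form n →L[ℝ] Form n →L[ℝ] ℝ :=
  LinearMap.toContinuousLinearMap
    ((LinearMap.toContinuousLinearMap (E := Form n) (F' := ℝ)).toLinearMap ∘ₗ
      (LinearMap.mul ℝ (Form n)).flip.compr₂ (topCoeff n))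

/-! ### Supercurrents -/

open TopologicalSpace (Opens)

/-- Supercurrents on an open set `Ω ⊆ ℝⁿ`: continuous linear functionals on the space of smooth
superforms with compact support in `Ω` (with its usual LF topology). Test forms of all bidegrees are
taken together, so this is the direct sum over `(p, q)` of the spaces of supercurrents of bidegree
`(p, q)`; the latter are the functionals that vanish on test forms of every bidegree other than
`(n - p, n - q)`. -/
abbrev Supercurrent {n : ℕ} (Ω : Opens (E n)) : Type := 𝓓(Ω, Form n) →L[ℝ] ℝ

/-- The exterior derivative of test superforms, `dφ = ∑ₖ dx_k ∧ ∂φ/∂x_k`. -/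
def dTest {n : ℕ} (Ω : Opens (E n)) : 𝓓(Ω, Form n) →L[ℝ] 𝓓(Ω, Form n) :=
  ∑ k : Fin n, (TestFunction.postcompCLM (wedgeLeft (dx k))).comp
    (TestFunction.lineDerivCLM ℝ (EuclideanSpace.single k (1 : ℝ)))

namespace Supercurrent

/-- The exterior derivative of a supercurrent: `dT.φ = (-1)^(k+1) T.dφ` for `T` of total degree `k`.
Only test forms `φ` of total degree `2n - k - 1` matter here, so the sign is `(-1)^(deg φ)`. -/
def d {n : ℕ} {Ω : Opens (E n)} (T : Supercurrent Ω) : Supercurrent Ω :=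
  T.comp ((dTest Ω).comp
    (TestFunction.postcompCLM (LinearMap.toContinuousLinearMap (degreeSign n).toLinearMap)))

/-- A supercurrent is closed if `dT = 0`. -/
def IsClosed {n : ℕ} {Ω : Opens (E n)} (T : Supercurrent Ω) : Prop := T.d = 0

/-- The wedge product `T ∧ α` with a constant-coefficient form: `(T ∧ α).φ = T.(α ∧ φ)`. -/
def wedge {n : ℕ} {Ω : Opens (E n)} (T : Supercurrent Ω) (a : Form n) : Supercurrent Ω :=
  T.comp (TestFunction.postcompCLM (wedgeLeft a))

end Supercurrent

/-! ### Submanifolds -/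

/-- `M` is a smooth (embedded) `m`-dimensional submanifold of the open set `Ω ⊆ ℝⁿ`, closed in `Ω`:
locally it is the zero set of `n - m` smooth functions whose differentials are linearly independent
on `M`. -/
structure IsSubmanifold {n : ℕ} (m : ℕ) (Ω : Opens (E n)) (M : Set (E n)) : Prop where
  subset : M ⊆ Ω
  closed : closure M ∩ Ω ⊆ M
  exists_defining : ∀ a ∈ M, ∃ (U : Set (E n)) (ρ : Fin (n - m) → E n → ℝ),
    IsOpen U ∧ a ∈ U ∧ (∀ j, ContDiffOn ℝ ∞ (ρ j) U) ∧
    M ∩ U = {x ∈ U | ∀ j, ρ j x = 0} ∧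
    ∀ x ∈ M ∩ U, LinearIndependent ℝ (fun j => fderiv ℝ (ρ j) x)

/-- The tangent space `T_x M`. -/
def tangentSpace {n : ℕ} (M : Set (E n)) (x : E n) : Submodule ℝ (E n) :=
  Submodule.span ℝ (tangentConeAt ℝ M x)

/-- The normal space `N_x M`. -/
def normalSpace {n : ℕ} (M : Set (E n)) (x : E n) : Submodule ℝ (E n) := (tangentSpace M x)ᗮ

/-- The `(1,0)`-form `∑ v_i dx_i` of a vector `v`. -/
def lower {n : ℕ} (v : E n) : Form n := ∑ i, v i • dx i

/-- The form `c_p ν ∧ ν^#` with `ν = n₁ ∧ … ∧ n_p` for an orthonormal basis `n₁, …, n_p` of the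
subspace `N` and `c_p = (-1)^(p(p-1)/2)`. It does not depend on the orthonormal basis. -/
def normalForm {n : ℕ} (N : Submodule ℝ (E n)) : Form n :=
  let p := Module.finrank ℝ N
  let ν : Form n := (List.ofFn fun j => lower (stdOrthonormalBasis ℝ N j : E n)).prod
  ((-1 : ℝ) ^ (p * (p - 1) / 2)) • (ν * J n ν)

/-- The supercurrent `[M]_s = c_p n ∧ n^# *dS_M` of an `m`-dimensional submanifold:
`[M]_s.φ = ∫_M topCoeff (c_p n ∧ n^# ∧ φ) dS_M`, where `dS_M` is the surface measure, i.e. the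
`m`-dimensional Hausdorff measure (normalised as Lebesgue measure on `m`-planes) restricted
to `M`. -/
def superCurrent {n : ℕ} (m : ℕ) (Ω : Opens (E n)) (M : Set (E n)) : Supercurrent Ω :=
  TestFunction.integralAgainstBilinCLM (pairing n) (μHE[m].restrict M)
    (fun x => normalForm (normalSpace M x))

/-! ### Mean curvature -/

/-- `ρ₁, …, ρ_{n-m}` are smooth defining functions of `M` in the open set `U` whose gradients
`n_j = ∇ρ_j` are orthonormal on `M`. -/
structure IsOrthonormalDefiningSystem {n : ℕ} (m : ℕ) (M U : Set (E n))
    (ρ : Fin (n - m) → E n → ℝ) : Prop where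
  isOpen : IsOpen U
  contDiffOn : ∀ j, ContDiffOn ℝ ∞ (ρ j) U
  inter_eq : M ∩ U = {x ∈ U | ∀ j, ρ j x = 0}
  orthonormal : ∀ x ∈ M ∩ U, Orthonormal ℝ (fun j => ∇ (ρ j) x)

/-- The trace `tr'` of the restriction of a bilinear form (i.e. a `(1,1)`-form at `x`) to `T_x M`. -/
def tangentialTrace {n : ℕ} (M : Set (E n)) (x : E n) (B : E n →L[ℝ] E n →L[ℝ] ℝ) : ℝ :=
  ∑ i, B (stdOrthonormalBasis ℝ (tangentSpace M x) i : E n)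
    (stdOrthonormalBasis ℝ (tangentSpace M x) i : E n)

/-- `H` is the mean curvature vector of `M` at `x`: `H = ∑ H_j n_j`, where `n_j = ∇ρ_j` for
defining functions `ρ_j` near `x` with gradients orthonormal on `M`, and `H_j` is the trace over
`T_x M` of `F_j = d n_j^# = ∑ (∂²ρ_j/∂x_k∂x_l) dx_k ∧ dξ_l`, i.e. of the Hessian of `ρ_j`. -/
def IsMeanCurvatureVector {n : ℕ} (m : ℕ) (M : Set (E n)) (x H : E n) : Prop :=
  ∃ (U : Set (E n)) (ρ : Fin (n - m) → E n → ℝ), x ∈ U ∧ IsOrthonormalDefiningSystem m M U ρ ∧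
    H = ∑ j, tangentialTrace M x (fderiv ℝ (fderiv ℝ (ρ j)) x) • ∇ (ρ j) x

/-- `M` is minimal: its mean curvature vector vanishes at every point. -/
def IsMinimal {n : ℕ} (m : ℕ) (M : Set (E n)) : Prop :=
  ∀ x ∈ M, IsMeanCurvatureVector m M x 0

end Super

end

/-!
Let `X` be the vector field whose components are the `dξ`-coefficients of the component of a
superform `φ` of bidegree `(0, 1)`. Since `⟨ν ∧ ν^# ∧ β^(m-1) ∧ dx_k ∧ dξ_l⟩` is, up to a constant,
the `(k, l)` entry of the orthogonal projection onto the tangent space, `d([M]_s ∧ β^(m-1)).φ` is a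
nonzero multiple of `∫_M div_M X dS_M`, the first variation of the area of `M` along `X`.

For `X` supported in the image of a parametrization `f` with metric `g`, the area formula and an
integration by parts turn this integral into `-∫ ⟪Δf, X ∘ f⟫`, where
`Δf = ∑ ∂_i (√(det g) g^{ij} ∂_j f)`. The vector `Δf` is normal to `M`, and its inner product with
`∇ρ_j` is `-√(det g)` times the tangential trace of the Hessian of `ρ_j`. Hence all these integrals
vanish if and only if the mean curvature vector does.
-/

noncomputable section

namespace Super

/-! ### The powers of `β` and the superforms `ν ∧ ν^#` -/

section

open ExteriorAlgebra Module

section NilpotentSums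

theorem mul_add_pow_of_mul_eq_zero {R : Type*} [Ring R] {x p q : R} (hx : x * p = 0)
    (hpq : Commute p q) (k : ℕ) : x * (p + q) ^ k = x * q ^ k := by
  induction k with
  | zero => simp
  | succ k ih =>
    rw [pow_succ, ← mul_assoc, ih, mul_add, mul_assoc x, ← (hpq.pow_right k).eq, ← mul_assoc, hx,
      zero_mul, zero_add, mul_assoc, ← pow_succ]

variable {R κ : Type*} [CommRing R] {z : κ → R}

theorem add_pow_succ_of_sq_eq_zero {z : R} (hz : z * z = 0) (S : R) (k : ℕ) :
    (z + S) ^ (k + 1) = S ^ (k + 1) + (k + 1) * (z * S ^ k) := by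
  induction k with
  | zero => simp [add_comm]
  | succ k ih =>
    rw [pow_succ, ih]
    push_cast
    linear_combination ((k : R) + 1) * S ^ k * hz

theorem prod_mul_eq_zero_of_mem (hz : ∀ i, z i * z i = 0) {s : Finset κ} {i : κ} (hi : i ∈ s) :
    (∏ j ∈ s, z j) * z i = 0 := by
  classical
  rw [← Finset.prod_erase_mul s z hi, mul_assoc, hz, mul_zero]

theorem sum_pow_card_of_sq_eq_zero (hz : ∀ i, z i * z i = 0) (s : Finset κ) :
    (∑ i ∈ s, z i) ^ s.card = (s.card.factorial : R) * ∏ i ∈ s, z i := by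
  classical
  induction s using Finset.induction_on with
  | empty => simp
  | insert a s ha ih =>
    rw [Finset.sum_insert ha, Finset.card_insert_of_notMem ha, add_pow_succ_of_sq_eq_zero (hz a),
      Finset.prod_insert ha, pow_succ, ih, mul_assoc, Finset.mul_sum,
      Finset.sum_eq_zero fun i hi => prod_mul_eq_zero_of_mem hz hi, Nat.factorial_succ]
    push_cast
    ring

theorem prod_mul_sum_pow_card_sdiff [DecidableEq κ] (hz : ∀ i, z i * z i = 0) {s t : Finset κ}
    (hst : s ⊆ t) :
    (∏ i ∈ s, z i) * (∑ i ∈ t, z i) ^ (t \ s).card =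
      ((t \ s).card.factorial : R) * ∏ i ∈ t, z i := by
  have hs : (∏ i ∈ s, z i) * ∑ i ∈ s, z i = 0 := by
    rw [Finset.mul_sum, Finset.sum_eq_zero fun i hi => prod_mul_eq_zero_of_mem hz hi]
  rw [← Finset.sum_sdiff hst, add_comm, mul_add_pow_of_mul_eq_zero hs (Commute.all _ _),
    sum_pow_card_of_sq_eq_zero hz, mul_left_comm, mul_comm (∏ i ∈ s, z i), Finset.prod_sdiff hst]

end NilpotentSums

section ExteriorMonomials

variable {R V : Type*} [CommRing R] [AddCommGroup V] [Module R V]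

theorem ι_mul_ι_swap (a b : V) : ι R a * ι R b = -(ι R b * ι R a) :=
  eq_neg_of_add_eq_zero_left (ι_add_mul_swap a b)

theorem ι_mul_ι_mem_center (a b : V) :
    ι R a * ι R b ∈ Subalgebra.center R (ExteriorAlgebra R V) := by
  rw [Subalgebra.mem_center_iff]
  intro c
  induction c using ExteriorAlgebra.induction with
  | algebraMap r => exact Algebra.commutes r _
  | ι x =>
    rw [← mul_assoc, ι_mul_ι_swap x a, neg_mul, mul_assoc, ι_mul_ι_swap x b, mul_neg, neg_neg,
      mul_assoc]
  | mul x y hx hy => rw [mul_assoc, hy, ← mul_assoc, hx, mul_assoc]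
  | add x y hx hy => rw [add_mul, mul_add, hx, hy]

theorem ι_mul_prod_map_ι (a : V) (l : List V) :
    ι R a * (l.map (ι R)).prod = (-1 : R) ^ l.length • ((l.map (ι R)).prod * ι R a) := by
  induction l with
  | nil => simp
  | cons b l ih =>
    rw [List.map_cons, List.prod_cons, ← mul_assoc, ι_mul_ι_swap, neg_mul, mul_assoc, ih,
      List.length_cons, pow_succ]
    simp [mul_assoc]

theorem ιInv_algebraMap (r : R) : ιInv (algebraMap R (ExteriorAlgebra R V) r) = 0 := by
  simp [ιInv, TrivSqZeroExt.algebraMap_eq_inl]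

theorem ιInv_ι_mul (v : V) (a : ExteriorAlgebra R V) :
    ιInv (ι R v * a) = algebraMapInv a • v := by
  let _ : Module Rᵐᵒᵖ V := Module.compHom _ ((RingHom.id R).fromOpposite mul_comm)
  have : IsCentralScalar R V := ⟨fun _ _ => rfl⟩
  have hfst : (TrivSqZeroExt.fstHom R R V).comp toTrivSqZeroExt = algebraMapInv := by
    ext; simp [algebraMapInv]
  have ha : (toTrivSqZeroExt a).fst = algebraMapInv a := DFunLike.congr_fun hfst a
  simp [ιInv, ha]

theorem induction_ι_mul {P : ExteriorAlgebra R V → Prop}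
    (algebraMap : ∀ r, P (algebraMap R _ r)) (add : ∀ a b, P a → P b → P (a + b))
    (ι_mul : ∀ v a, P a → P (ι R v * a)) (a : ExteriorAlgebra R V) : P a :=
  CliffordAlgebra.left_induction (Q := 0) algebraMap add (fun a v => ι_mul v a) a

end ExteriorMonomials

section AdaptedBasis

variable {F : Type*} [NormedAddCommGroup F] [InnerProductSpace ℝ F] [FiniteDimensional ℝ F]

theorem sum_orthonormalBasis_eq {W κ κ' : Type*} [AddCommGroup W] [Module ℝ W] [Fintype κ]
    [Fintype κ'] (b : OrthonormalBasis κ ℝ F) (c : OrthonormalBasis κ' ℝ F)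
    (B : F →ₗ[ℝ] F →ₗ[ℝ] W) : ∑ i, B (b i) (b i) = ∑ k, B (c k) (c k) := by
  have h := congrArg (TensorProduct.lift B)
    ((InnerProductSpace.canonicalCovariantTensor_eq_sum F b).symm.trans
      (InnerProductSpace.canonicalCovariantTensor_eq_sum F c))
  simpa only [map_sum, TensorProduct.lift.tmul] using h

/-- The orthonormal basis adapted to the decomposition `T ⊕ Tᗮ` of the ambient space. -/
def adaptedBasis (T : Submodule ℝ F) :
    OrthonormalBasis (Fin (finrank ℝ T) ⊕ Fin (finrank ℝ Tᗮ)) ℝ F :=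
  ((stdOrthonormalBasis ℝ T).prod (stdOrthonormalBasis ℝ Tᗮ)).map T.orthogonalDecomposition.symm

theorem adaptedBasis_inl (T : Submodule ℝ F) (i : Fin (finrank ℝ T)) :
    adaptedBasis T (Sum.inl i) = stdOrthonormalBasis ℝ T i := by
  simp [adaptedBasis]

theorem adaptedBasis_inr (T : Submodule ℝ F) (j : Fin (finrank ℝ Tᗮ)) :
    adaptedBasis T (Sum.inr j) = stdOrthonormalBasis ℝ Tᗮ j := by
  simp [adaptedBasis]

end AdaptedBasis

end

section

open ExteriorAlgebra Module

variable {n : ℕ}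

section Covectors

/-- The covector `∑ v_i dx_i` of a vector `v`; `lower v` is its image in the exterior algebra. -/
def covector : E n →ₗ[ℝ] Covector n where
  toFun v k := if (ofLex k).2 = 0 then v (ofLex k).1 else 0
  map_add' v w := by funext k; by_cases h : (ofLex k).2 = 0 <;> simp [h]
  map_smul' c v := by funext k; by_cases h : (ofLex k).2 = 0 <;> simp [h]

theorem covector_single (i : Fin n) :
    covector (EuclideanSpace.single i (1 : ℝ)) = Pi.single (toLex (i, 0)) 1 := by
  funext k
  obtain ⟨⟨k, l⟩, rfl⟩ := toLex.surjective k
  by_cases hl : l = 0 <;> by_cases hk : k = i <;>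
    simp_all [covector, Prod.ext_iff]

theorem covectorJ_covector_single (i : Fin n) :
    covectorJ n (covector (EuclideanSpace.single i (1 : ℝ))) = Pi.single (toLex (i, 1)) 1 := by
  funext k
  obtain ⟨⟨k, l⟩, rfl⟩ := toLex.surjective k
  fin_cases l <;> by_cases hk : k = i <;>
    simp_all [covector, covectorJ, Prod.ext_iff]

theorem lower_eq_ι (v : E n) : lower v = ι ℝ (covector v) := by
  conv_rhs => rw [← (EuclideanSpace.basisFun (Fin n) ℝ).sum_repr v]
  simp [lower, dx, covector_single]

theorem J_lower_eq_ι (v : E n) : J n (lower v) = ι ℝ (covectorJ n (covector v)) := by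
  rw [lower_eq_ι, J, map_apply_ι]

theorem dx_eq_lower (i : Fin n) : dx i = lower (EuclideanSpace.single i (1 : ℝ)) := by
  rw [lower_eq_ι, covector_single, dx]

theorem dxi_eq_J_lower (i : Fin n) : dxi i = J n (lower (EuclideanSpace.single i (1 : ℝ))) := by
  rw [J_lower_eq_ι, covectorJ_covector_single, dxi]

theorem lower_mul_self (u : E n) : lower u * lower u = 0 := by
  rw [lower_eq_ι, ι_sq_zero]

theorem J_lower_mul_self (u : E n) : J n (lower u) * J n (lower u) = 0 := by
  rw [J_lower_eq_ι, ι_sq_zero]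

theorem lower_eq_sum {κ : Type*} [Fintype κ] (b : OrthonormalBasis κ ℝ (E n)) (u : E n) :
    lower u = ∑ i, inner ℝ (b i) u • lower (b i) := by
  conv_lhs => rw [← b.sum_repr' u]
  simp [lower_eq_ι]

/-- The vector formed by the `dx` components of a covector. -/
def xPart : Covector n →ₗ[ℝ] E n where
  toFun v := WithLp.toLp 2 fun i => v (toLex (i, 0))
  map_add' _ _ := rfl
  map_smul' _ _ := rfl

/-- The vector formed by the `dξ` components of a covector. -/
def xiPart : Covector n →ₗ[ℝ] E n where
  toFun v := WithLp.toLp 2 fun i => v (toLex (i, 1))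
  map_add' _ _ := rfl
  map_smul' _ _ := rfl

theorem ι_eq_lower_add_J_lower (v : Covector n) :
    ι ℝ v = lower (xPart v) + J n (lower (xiPart v)) := by
  rw [J_lower_eq_ι, lower_eq_ι, ← map_add]
  congr 1
  funext k
  obtain ⟨⟨k, l⟩, rfl⟩ := toLex.surjective k
  fin_cases l <;> simp [covector, covectorJ] <;> rfl

end Covectors

section KahlerProducts

/-- The bilinear map `(u, v) ↦ u ∧ v^#` from vectors to `(1,1)`-forms. -/
def kahler : E n →ₗ[ℝ] E n →ₗ[ℝ] Form n :=
  (LinearMap.mul ℝ (Form n)).compl₁₂ (ι ℝ ∘ₗ covector) (ι ℝ ∘ₗ covectorJ n ∘ₗ covector)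

theorem kahler_apply (u v : E n) : kahler u v = lower u * J n (lower v) := by
  rw [J_lower_eq_ι, lower_eq_ι]; rfl

theorem beta_eq_sum_kahler {κ : Type*} [Fintype κ] (b : OrthonormalBasis κ ℝ (E n)) :
    beta n = ∑ i, kahler (b i) (b i) := by
  rw [sum_orthonormalBasis_eq b (EuclideanSpace.basisFun (Fin n) ℝ), beta]
  simp [kahler_apply, dx_eq_lower, dxi_eq_J_lower]

theorem prod_lower_mul_J (l : List (E n)) :
    (-1 : ℝ) ^ (l.length * (l.length - 1) / 2) •
      ((l.map lower).prod * J n (l.map lower).prod) = (l.map fun v => kahler v v).prod := by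
  induction l with
  | nil => simp
  | cons v l ih =>
    have hswap : (l.map lower).prod * J n (lower v) =
        (-1 : ℝ) ^ l.length • (J n (lower v) * (l.map lower).prod) := by
      have hl : l.map lower = (l.map covector).map (ι ℝ) := by
        simp [List.map_map, Function.comp_def, lower_eq_ι]
      rw [hl, J_lower_eq_ι, ι_mul_prod_map_ι, List.length_map, smul_smul, ← mul_pow]
      simp
    rw [List.length_cons, Nat.triangle_succ, pow_add, mul_smul, List.map_cons, List.map_cons,
      List.prod_cons, List.prod_cons, ← ih, kahler_apply, map_mul]
    calc _ = (-1 : ℝ) ^ (l.length * (l.length - 1) / 2) • (-1 : ℝ) ^ l.length •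
          (lower v * ((l.map lower).prod * J n (lower v)) * J n (l.map lower).prod) := by
          simp only [mul_assoc]
      _ = _ := by
          rw [hswap]
          simp only [mul_smul_comm, smul_mul_assoc, smul_smul, mul_assoc, ← mul_pow]
          simp

/-- The form `v ∧ v^#`, as an element of the (commutative) center of the algebra of forms. -/
def kahlerSq (v : E n) : Subalgebra.center ℝ (Form n) :=
  ⟨kahler v v, by rw [kahler_apply, J_lower_eq_ι, lower_eq_ι]; exact ι_mul_ι_mem_center _ _⟩

/-- The central form `∏ j ∈ s, b_j ∧ b_j^#` of a family of vectors `b`. -/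
def kahlerProd {κ : Type*} (b : κ → E n) (s : Finset κ) : Subalgebra.center ℝ (Form n) :=
  ∏ j ∈ s, kahlerSq (b j)

/-- The form `dx₁ ∧ dξ₁ ∧ … ∧ dx_n ∧ dξ_n`. -/
def topForm (n : ℕ) : Subalgebra.center ℝ (Form n) :=
  kahlerProd (EuclideanSpace.basisFun (Fin n) ℝ) Finset.univ

theorem coe_kahlerSq (v : E n) : (kahlerSq v : Form n) = lower v * J n (lower v) :=
  kahler_apply v v

theorem mul_center_comm (a : Form n) (c : Subalgebra.center ℝ (Form n)) : a * c = c * a :=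
  Subalgebra.mem_center_iff.1 c.2 a

theorem lower_mul_kahlerSq (v : E n) : lower v * kahlerSq v = 0 := by
  rw [coe_kahlerSq, ← mul_assoc, lower_mul_self, zero_mul]

theorem kahlerSq_mul_J_lower (v : E n) : (kahlerSq v : Form n) * J n (lower v) = 0 := by
  rw [coe_kahlerSq, mul_assoc, J_lower_mul_self, mul_zero]

theorem kahlerSq_mul_self (v : E n) : kahlerSq v * kahlerSq v = 0 := by
  apply Subtype.ext
  rw [MulMemClass.coe_mul]
  nth_rw 1 [coe_kahlerSq]
  rw [mul_assoc, mul_center_comm, kahlerSq_mul_J_lower, mul_zero, ZeroMemClass.coe_zero]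

theorem beta_eq_sum_kahlerSq {κ : Type*} [Fintype κ] (b : OrthonormalBasis κ ℝ (E n)) :
    beta n = (∑ i, kahlerSq (b i) : Subalgebra.center ℝ (Form n)) := by
  rw [beta_eq_sum_kahler b]
  simp [kahlerSq]

theorem lower_mul_kahlerProd {κ : Type*} (b : κ → E n) {s : Finset κ} {i : κ} (hi : i ∈ s) :
    lower (b i) * kahlerProd b s = 0 := by
  classical
  rw [kahlerProd, ← Finset.mul_prod_erase s _ hi, MulMemClass.coe_mul, ← mul_assoc,
    lower_mul_kahlerSq, zero_mul]

theorem kahlerProd_mul_J_lower {κ : Type*} (b : κ → E n) {s : Finset κ} {i : κ} (hi : i ∈ s) :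
    (kahlerProd b s : Form n) * J n (lower (b i)) = 0 := by
  classical
  rw [kahlerProd, ← Finset.prod_erase_mul s _ hi, MulMemClass.coe_mul, mul_assoc,
    kahlerSq_mul_J_lower, mul_zero]

theorem kahlerProd_mul_beta_pow {κ : Type*} [Fintype κ] [DecidableEq κ]
    (b : OrthonormalBasis κ ℝ (E n)) (s : Finset κ) :
    (kahlerProd b s : Form n) * beta n ^ sᶜ.card =
      (sᶜ.card.factorial : ℝ) • (kahlerProd b Finset.univ : Form n) := by
  have h := prod_mul_sum_pow_card_sdiff (fun j => kahlerSq_mul_self (b j)) (Finset.subset_univ s)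
  rw [← Finset.compl_eq_univ_sdiff] at h
  rw [beta_eq_sum_kahlerSq b, ← SubmonoidClass.coe_pow, ← MulMemClass.coe_mul, kahlerProd, h,
    ← nsmul_eq_mul, ← Nat.cast_smul_eq_nsmul ℝ]
  rfl

theorem kahlerProd_univ {κ : Type*} [Fintype κ] (b : OrthonormalBasis κ ℝ (E n)) :
    kahlerProd b Finset.univ = topForm n := by
  classical
  have hcard : Fintype.card κ = n := by
    simpa using (finrank_eq_card_basis b.toBasis).symm
  have h1 := kahlerProd_mul_beta_pow b ∅
  have h2 := kahlerProd_mul_beta_pow (EuclideanSpace.basisFun (Fin n) ℝ) ∅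
  simp only [kahlerProd, Finset.prod_empty, Finset.compl_empty, Finset.card_univ, hcard,
    Fintype.card_fin, OneMemClass.coe_one, one_mul] at h1 h2
  exact Subtype.ext (smul_right_injective _ (Nat.cast_ne_zero.2 n.factorial_ne_zero)
    (h1.symm.trans h2))

theorem lower_mul_topForm (u : E n) : lower u * topForm n = 0 := by
  rw [lower_eq_sum (EuclideanSpace.basisFun (Fin n) ℝ), Finset.sum_mul]
  refine Finset.sum_eq_zero fun i _ => ?_
  rw [smul_mul_assoc, topForm, lower_mul_kahlerProd _ (Finset.mem_univ i), smul_zero]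

theorem topForm_mul_J_lower (u : E n) : (topForm n : Form n) * J n (lower u) = 0 := by
  rw [lower_eq_sum (EuclideanSpace.basisFun (Fin n) ℝ), map_sum, Finset.mul_sum]
  refine Finset.sum_eq_zero fun i _ => ?_
  rw [map_smul, mul_smul_comm, topForm, kahlerProd_mul_J_lower _ (Finset.mem_univ i), smul_zero]

theorem topForm_mul (a : Form n) :
    (topForm n : Form n) * a = algebraMapInv a • (topForm n : Form n) := by
  induction a using ExteriorAlgebra.induction with
  | algebraMap r => simp [← Algebra.commutes, Algebra.smul_def]
  | ι v =>
    rw [ι_eq_lower_add_J_lower, mul_add, ← mul_center_comm, lower_mul_topForm, topForm_mul_J_lower,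
      ← ι_eq_lower_add_J_lower, algebraMapInv, lift_ι_apply, LinearMap.zero_apply, zero_smul,
      add_zero]
  | mul x y hx hy => rw [← mul_assoc, hx, smul_mul_assoc, hy, smul_smul, map_mul]
  | add x y hx hy => rw [mul_add, hx, hy, map_add, add_smul]

end KahlerProducts

section Contraction

variable {κ : Type*} [Fintype κ] (b : OrthonormalBasis κ ℝ (E n)) (s : Finset κ)

theorem kahlerProd_mul_beta_pow_mul_lower_of_mem {i : κ} (hi : i ∈ s) (k : ℕ) :
    (kahlerProd b s : Form n) * beta n ^ k * lower (b i) = 0 := by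
  rw [beta_eq_sum_kahlerSq b, ← SubmonoidClass.coe_pow, ← MulMemClass.coe_mul, ← mul_center_comm,
    MulMemClass.coe_mul, ← mul_assoc, lower_mul_kahlerProd _ hi, zero_mul]

variable [DecidableEq κ]

-- `b_i` annihilates the `i`-th summand of `β`, so only the other summands contribute.
theorem kahlerProd_mul_beta_pow_mul_lower_of_notMem {i : κ} (hi : i ∉ s) :
    (kahlerProd b s : Form n) * beta n ^ (sᶜ.card - 1) * lower (b i) =
      ((sᶜ.card - 1).factorial : ℝ) • (lower (b i) * kahlerProd b (Finset.univ.erase i)) := by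
  set z : κ → Subalgebra.center ℝ (Form n) := fun j => kahlerSq (b j)
  have hcard : (Finset.univ.erase i \ s).card = sᶜ.card - 1 := by
    rw [Finset.erase_sdiff_comm, ← Finset.compl_eq_univ_sdiff,
      Finset.card_erase_of_mem (Finset.mem_compl.2 hi)]
  have hsub : s ⊆ Finset.univ.erase i := fun j hj =>
    Finset.mem_erase.2 ⟨ne_of_mem_of_not_mem hj hi, Finset.mem_univ j⟩
  have hprod := prod_mul_sum_pow_card_sdiff (fun j => kahlerSq_mul_self (b j)) hsub
  rw [hcard, ← nsmul_eq_mul, ← Nat.cast_smul_eq_nsmul ℝ] at hprod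
  calc (kahlerProd b s : Form n) * beta n ^ (sᶜ.card - 1) * lower (b i)
      = lower (b i) * (z i + ∑ j ∈ Finset.univ.erase i, z j :) ^ (sᶜ.card - 1) *
          kahlerProd b s := by
        rw [beta_eq_sum_kahlerSq b, ← Finset.add_sum_erase _ _ (Finset.mem_univ i),
          ← SubmonoidClass.coe_pow, ← MulMemClass.coe_mul, ← mul_center_comm, mul_comm,
          MulMemClass.coe_mul, mul_assoc]
    _ = lower (b i) * (kahlerProd b s * (∑ j ∈ Finset.univ.erase i, z j) ^ (sᶜ.card - 1) :) := by
        rw [AddMemClass.coe_add, mul_add_pow_of_mul_eq_zero (lower_mul_kahlerSq (b i))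
          (mul_center_comm _ _), mul_assoc, mul_comm (kahlerProd b s), MulMemClass.coe_mul,
          SubmonoidClass.coe_pow]
    _ = _ := by
        rw [kahlerProd, hprod, Subalgebra.coe_smul, mul_smul_comm, kahlerProd]

theorem kahlerProd_mul_beta_pow_mul_lower_mul_lower (u w : E n) :
    (kahlerProd b s : Form n) * beta n ^ (sᶜ.card - 1) * lower u * lower w = 0 := by
  rw [lower_eq_sum b u, Finset.mul_sum, Finset.sum_mul]
  refine Finset.sum_eq_zero fun i _ => ?_
  rw [mul_smul_comm, smul_mul_assoc]
  by_cases hi : i ∈ s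
  · rw [kahlerProd_mul_beta_pow_mul_lower_of_mem b s hi, zero_mul, smul_zero]
  rw [lower_eq_sum b w, Finset.mul_sum, Finset.sum_eq_zero fun j _ => ?_, smul_zero]
  rw [kahlerProd_mul_beta_pow_mul_lower_of_notMem b s hi, smul_mul_assoc, mul_smul_comm,
    mul_assoc, ← mul_center_comm]
  rcases eq_or_ne j i with rfl | hij
  · rw [← mul_assoc, lower_mul_self, zero_mul, smul_zero, smul_zero]
  · rw [lower_mul_kahlerProd _ (Finset.mem_erase.2 ⟨hij, Finset.mem_univ j⟩), mul_zero, smul_zero,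
      smul_zero]

theorem lower_mul_kahlerProd_erase_mul_J_lower (i : κ) (w : E n) :
    lower (b i) * kahlerProd b (Finset.univ.erase i) * J n (lower w) =
      inner ℝ (b i) w • (topForm n : Form n) := by
  rw [lower_eq_sum b w, map_sum, Finset.mul_sum, Finset.sum_eq_single_of_mem i (Finset.mem_univ i)]
  · rw [map_smul, mul_smul_comm, mul_assoc, ← mul_center_comm, ← mul_assoc, ← coe_kahlerSq,
      ← MulMemClass.coe_mul, kahlerProd,
      Finset.mul_prod_erase _ (fun j => kahlerSq (b j)) (Finset.mem_univ i), ← kahlerProd_univ b,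
      kahlerProd]
  · intro j _ hj
    rw [map_smul, mul_smul_comm, mul_assoc,
      kahlerProd_mul_J_lower _ (Finset.mem_erase.2 ⟨hj, Finset.mem_univ j⟩), mul_zero, smul_zero]

theorem kahlerProd_mul_beta_pow_mul_lower_mul_J_lower (u w : E n) :
    (kahlerProd b s : Form n) * beta n ^ (sᶜ.card - 1) * lower u * J n (lower w) =
      (((sᶜ.card - 1).factorial : ℝ) * ∑ i ∈ sᶜ, inner ℝ (b i) u * inner ℝ (b i) w) •
        (topForm n : Form n) := by
  rw [lower_eq_sum b u, Finset.mul_sum, Finset.sum_mul, Finset.mul_sum, Finset.sum_smul,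
    ← Finset.sum_subset (Finset.subset_univ sᶜ)]
  · refine Finset.sum_congr rfl fun i hi => ?_
    rw [mul_smul_comm,
      kahlerProd_mul_beta_pow_mul_lower_of_notMem b s (Finset.mem_compl.1 hi), smul_mul_assoc,
      smul_mul_assoc, lower_mul_kahlerProd_erase_mul_J_lower, smul_smul, smul_smul,
      mul_left_comm, mul_assoc]
  · intro i _ hi
    rw [mul_smul_comm, kahlerProd_mul_beta_pow_mul_lower_of_mem b s (by simpa using hi), smul_zero,
      zero_mul]

end Contraction

end

section

open ExteriorAlgebra Module

variable {n : ℕ}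

section TopCoefficient

theorem monomials_apply (s : Finset (Fin n ×ₗ Fin 2)) :
    monomials n s = ιMulti ℝ s.card (Pi.basisFun ℝ _ ∘ s.orderEmbOfFin rfl) := by
  rw [monomials, basis_apply]
  rfl

theorem monomials_eq_prod_sort (s : Finset (Fin n ×ₗ Fin 2)) :
    monomials n s = (s.sort.map fun k => ι ℝ (Pi.single k 1)).prod := by
  rw [monomials_apply, ιMulti_apply]
  congr 1
  refine List.ext_getElem (by simp) fun i _ _ => ?_
  simp [Finset.orderEmbOfFin_apply]

theorem sort_univ_prod_lex :
    (Finset.univ : Finset (Fin n ×ₗ Fin 2)).sort =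
      (List.finRange n).flatMap fun i => [toLex (i, 0), toLex (i, 1)] := by
  set l := (List.finRange n).flatMap fun i => [toLex (i, (0 : Fin 2)), toLex (i, 1)]
  have hlt : l.Pairwise (· < ·) := by
    rw [List.pairwise_flatMap]
    refine ⟨fun i _ => by simp [Prod.Lex.toLex_lt_toLex],
      (List.pairwise_lt_finRange n).imp fun {i j} hij => ?_⟩
    simp [Prod.Lex.toLex_lt_toLex, hij]
  have huniv : l.toFinset = Finset.univ := by
    ext a
    obtain ⟨⟨i, k⟩, rfl⟩ := toLex.surjective a
    fin_cases k <;> simp [l]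
  rw [← huniv]
  exact (List.toFinset_sort _ (hlt.imp ne_of_lt)).2 (hlt.imp le_of_lt)

theorem coe_topForm :
    (topForm n : Form n) = ((List.finRange n).map fun i => dx i * dxi i).prod := by
  rw [topForm, kahlerProd, Fin.prod_univ_def, ← Subalgebra.coe_val, map_list_prod, List.map_map]
  simp [Function.comp_def, coe_kahlerSq, dx_eq_lower, dxi_eq_J_lower]

theorem topCoeff_topForm : topCoeff n (topForm n) = 1 := by
  have h : (topForm n : Form n) = monomials n Finset.univ := by
    rw [coe_topForm, monomials_eq_prod_sort, sort_univ_prod_lex, List.map_flatMap, List.flatMap,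
      List.prod_flatten, List.map_map]
    simp [Function.comp_def, dx, dxi]
  rw [h, topCoeff, Basis.coord_apply, Basis.repr_self, Finsupp.single_eq_same]

end TopCoefficient

section DegreeSign

theorem degreeSign_ι (v : Covector n) : degreeSign n (ι ℝ v) = -ι ℝ v := by
  simp [degreeSign]

theorem degreeSign_lower (v : E n) : degreeSign n (lower v) = -lower v := by
  rw [lower_eq_ι, degreeSign_ι]

theorem degreeSign_kahler (u v : E n) : degreeSign n (kahler u v) = kahler u v := by
  rw [kahler_apply, map_mul, degreeSign_lower, J_lower_eq_ι, degreeSign_ι, neg_mul_neg]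

theorem degreeSign_beta : degreeSign n (beta n) = beta n := by
  rw [beta_eq_sum_kahler (EuclideanSpace.basisFun (Fin n) ℝ), map_sum]
  simp only [degreeSign_kahler]

theorem degreeSign_kahlerProd {κ : Type*} (b : κ → E n) (s : Finset κ) :
    degreeSign n (kahlerProd b s) = kahlerProd b s := by
  classical
  induction s using Finset.induction_on with
  | empty => simp [kahlerProd]
  | insert a s ha ih =>
    rw [kahlerProd] at ih ⊢
    rw [Finset.prod_insert ha, MulMemClass.coe_mul, map_mul, ih, kahlerSq, degreeSign_kahler]

theorem degreeSign_monomials (s : Finset (Fin n ×ₗ Fin 2)) :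
    degreeSign n (monomials n s) = (-1 : ℝ) ^ s.card • monomials n s := by
  rw [monomials_apply, degreeSign, map_apply_ιMulti]
  have h := (ιMulti ℝ s.card).map_smul_univ (fun _ => (-1 : ℝ))
    (Pi.basisFun ℝ (Fin n ×ₗ Fin 2) ∘ s.orderEmbOfFin rfl)
  rw [Finset.prod_const, Finset.card_univ, Fintype.card_fin] at h
  rw [← h]
  congr 1
  funext i
  simp

theorem topCoeff_degreeSign (a : Form n) : topCoeff n (degreeSign n a) = topCoeff n a := by
  suffices topCoeff n ∘ₗ (degreeSign n).toLinearMap = topCoeff n from LinearMap.congr_fun this a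
  refine (monomials n).ext fun s => ?_
  rw [LinearMap.comp_apply, AlgHom.toLinearMap_apply, degreeSign_monomials, map_smul, topCoeff,
    Basis.coord_apply, Basis.repr_self]
  rcases eq_or_ne s Finset.univ with rfl | hs
  · have hcard : (Finset.univ : Finset (Fin n ×ₗ Fin 2)).card = n * 2 := by
      rw [Finset.card_univ, Fintype.card_lex]; simp
    rw [hcard, (even_two.mul_left n).neg_one_pow, one_smul]
  · rw [Finsupp.single_eq_of_ne' hs, smul_zero]

theorem topCoeff_eq_zero_of_degreeSign {a : Form n} (h : degreeSign n a = -a) :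
    topCoeff n a = 0 := by
  have hneg := topCoeff_degreeSign a
  rw [h, map_neg] at hneg
  linarith

end DegreeSign

section XiVector

/-- The vector `w` for which `∑ w_i dξ_i` is the component of bidegree `(0, 1)` of a form. -/
def xiVector : Form n →ₗ[ℝ] E n := xiPart ∘ₗ ιInv

theorem xiVector_J_lower (w : E n) : xiVector (J n (lower w)) = w := by
  rw [xiVector, LinearMap.comp_apply, J_lower_eq_ι, ι_leftInverse]
  ext i
  change covectorJ n (covector w) (toLex (i, 1)) = w i
  simp [covectorJ, covector]

theorem xiVector_degreeSign (a : Form n) : xiVector (degreeSign n a) = -xiVector a := by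
  have h := LinearMap.congr_fun (ιInv_comp_map (-(LinearMap.id : Covector n →ₗ[ℝ] Covector n))) a
  rw [LinearMap.comp_apply, AlgHom.toLinearMap_apply, LinearMap.comp_apply] at h
  rw [xiVector, LinearMap.comp_apply, LinearMap.comp_apply, degreeSign, h, LinearMap.neg_apply,
    map_neg, LinearMap.id_apply]

theorem topCoeff_kahlerProd_mul_beta_pow_mul_lower_mul {κ : Type*} [Fintype κ] [DecidableEq κ]
    (b : OrthonormalBasis κ ℝ (E n)) (s : Finset κ) (u : E n) (a : Form n) :
    topCoeff n ((kahlerProd b s : Form n) * beta n ^ (sᶜ.card - 1) * lower u * a) =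
      ((sᶜ.card - 1).factorial : ℝ) * ∑ i ∈ sᶜ, inner ℝ (b i) u * inner ℝ (b i) (xiVector a) := by
  set c := (kahlerProd b s : Form n) * beta n ^ (sᶜ.card - 1) * lower u with hc
  have hodd : degreeSign n c = -c := by
    rw [hc, map_mul, map_mul, map_pow, degreeSign_lower, degreeSign_beta, degreeSign_kahlerProd,
      mul_neg]
  have hι (v : Covector n) : c * ι ℝ v = (((sᶜ.card - 1).factorial : ℝ) *
      ∑ i ∈ sᶜ, inner ℝ (b i) u * inner ℝ (b i) (xiPart v)) • (topForm n : Form n) := by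
    rw [ι_eq_lower_add_J_lower, mul_add, hc, kahlerProd_mul_beta_pow_mul_lower_mul_lower, zero_add,
      kahlerProd_mul_beta_pow_mul_lower_mul_J_lower]
  induction a using induction_ι_mul with
  | algebraMap r =>
    rw [xiVector, LinearMap.comp_apply, ιInv_algebraMap, ← Algebra.commutes, ← Algebra.smul_def,
      map_smul, topCoeff_eq_zero_of_degreeSign hodd]
    simp
  | add x y hx hy =>
    rw [mul_add, map_add, map_add, hx, hy, ← mul_add, ← Finset.sum_add_distrib]
    simp only [inner_add_right, mul_add]
  | ι_mul v x _ =>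
    rw [← mul_assoc, hι, smul_mul_assoc, topForm_mul, map_smul, map_smul, topCoeff_topForm,
      xiVector, LinearMap.comp_apply, ιInv_ι_mul, map_smul]
    simp only [inner_smul_right, smul_eq_mul, mul_one, Finset.mul_sum, Finset.sum_mul]
    exact Finset.sum_congr rfl fun i _ => by ring

end XiVector

section NormalForm

theorem normalForm_eq_kahlerProd (N : Submodule ℝ (E n)) :
    normalForm N = kahlerProd (fun j => (stdOrthonormalBasis ℝ N j : E n)) Finset.univ := by
  have h := prod_lower_mul_J (List.ofFn fun j => (stdOrthonormalBasis ℝ N j : E n))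
  rw [List.length_ofFn, List.map_ofFn, List.map_ofFn] at h
  refine h.trans ?_
  rw [kahlerProd, ← List.prod_ofFn, ← Subalgebra.coe_val, map_list_prod, List.map_ofFn]
  rfl

theorem beta_sub_sum_kahler (T : Submodule ℝ (E n)) :
    beta n - ∑ i, kahler (stdOrthonormalBasis ℝ T i : E n) (stdOrthonormalBasis ℝ T i : E n) =
      (∑ j, kahlerSq (stdOrthonormalBasis ℝ Tᗮ j : E n) : Subalgebra.center ℝ (Form n)) := by
  rw [beta_eq_sum_kahler (adaptedBasis T), Fintype.sum_sum_type]
  simp [adaptedBasis_inl, adaptedBasis_inr, kahlerSq]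

-- This form of the normal form depends visibly continuously on the tangent space.
theorem normalForm_orthogonal (T : Submodule ℝ (E n)) :
    normalForm Tᗮ = ((n - finrank ℝ T).factorial : ℝ)⁻¹ •
      (beta n - ∑ i, kahler (stdOrthonormalBasis ℝ T i : E n) (stdOrthonormalBasis ℝ T i : E n)) ^
        (n - finrank ℝ T) := by
  have hrank : finrank ℝ Tᗮ = n - finrank ℝ T := by
    have := T.finrank_add_finrank_orthogonal
    rw [finrank_euclideanSpace_fin] at this
    omega
  have h := sum_pow_card_of_sq_eq_zero
    (fun j => kahlerSq_mul_self (stdOrthonormalBasis ℝ Tᗮ j : E n)) Finset.univ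
  rw [Finset.card_univ, Fintype.card_fin, ← nsmul_eq_mul, ← Nat.cast_smul_eq_nsmul ℝ] at h
  rw [beta_sub_sum_kahler, ← hrank, ← SubmonoidClass.coe_pow, h, normalForm_eq_kahlerProd,
    Subalgebra.coe_smul, smul_smul, inv_mul_cancel₀ (Nat.cast_ne_zero.2 (Nat.factorial_ne_zero _)),
    one_smul, kahlerProd]

theorem topCoeff_normalForm_mul (T : Submodule ℝ (E n)) (u : E n) (a : Form n) :
    topCoeff n (normalForm Tᗮ * (beta n ^ (finrank ℝ T - 1) * (lower u * a))) =
      ((finrank ℝ T - 1).factorial : ℝ) * ∑ i, inner ℝ (stdOrthonormalBasis ℝ T i : E n) u *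
        inner ℝ (stdOrthonormalBasis ℝ T i : E n) (xiVector a) := by
  classical
  have h := topCoeff_kahlerProd_mul_beta_pow_mul_lower_mul (adaptedBasis T)
    (Finset.univ.map Function.Embedding.inr) u a
  have hcompl : (Finset.univ.map (Function.Embedding.inr :
      Fin (finrank ℝ Tᗮ) ↪ Fin (finrank ℝ T) ⊕ Fin (finrank ℝ Tᗮ)))ᶜ =
      Finset.univ.map Function.Embedding.inl := by
    ext (i | i) <;> simp
  rw [hcompl, Finset.card_map, Finset.card_univ, Fintype.card_fin, kahlerProd, Finset.prod_map,
    Finset.sum_map] at h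
  simp only [Function.Embedding.inl_apply, Function.Embedding.inr_apply, adaptedBasis_inl,
    adaptedBasis_inr] at h
  rw [← h, normalForm_eq_kahlerProd, kahlerProd]
  simp only [mul_assoc]

end NormalForm

end

/-! ### Gram matrices -/

section

open Module Matrix

section GramDual

variable {F W ι : Type*} [NormedAddCommGroup F] [InnerProductSpace ℝ F] [AddCommGroup W]
  [Module ℝ W] [Fintype ι] [DecidableEq ι]

/-- The frame dual to `A` in the span of `A`, for a linearly independent family `A`. -/
def gramDual (A : ι → F) (i : ι) : F := ∑ j, (gram ℝ A)⁻¹ i j • A j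

theorem det_gram_pos {A : ι → F} (hA : LinearIndependent ℝ A) : 0 < (gram ℝ A).det :=
  (posDef_gram_of_linearIndependent (𝕜 := ℝ) hA).det_pos

theorem inner_gramDual {A : ι → F} (hA : LinearIndependent ℝ A) (i j : ι) :
    inner ℝ (gramDual A i) (A j) = if i = j then 1 else 0 := by
  have h : (gram ℝ A)⁻¹ * gram ℝ A = 1 := nonsing_inv_mul _ (det_gram_pos hA).ne'.isUnit
  have hij := congrFun (congrFun h i) j
  rw [mul_apply, one_apply] at hij
  simpa only [gramDual, sum_inner, real_inner_smul_left, gram_apply] using hij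

theorem gram_inv_symm (A : ι → F) (i j : ι) : (gram ℝ A)⁻¹ i j = (gram ℝ A)⁻¹ j i := by
  have h : (gram ℝ A)⁻¹.IsHermitian := (isHermitian_gram ℝ A).inv
  simpa using h.apply j i

theorem sum_inner_smul_gramDual {A : ι → F} (hA : LinearIndependent ℝ A) {x : F}
    (hx : x ∈ Submodule.span ℝ (Set.range A)) : ∑ i, inner ℝ (A i) x • gramDual A i = x := by
  let P : F →ₗ[ℝ] F := ∑ i, (innerₗ F (A i)).smulRight (gramDual A i)
  have hP : Set.EqOn P (LinearMap.id : F →ₗ[ℝ] F) (Set.range A) := by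
    rintro _ ⟨k, rfl⟩
    calc P (A k) = ∑ i, inner ℝ (A i) (A k) • ∑ j, (gram ℝ A)⁻¹ i j • A j := by
          simp [P, gramDual]
      _ = ∑ i, ∑ j, (gram ℝ A)⁻¹ j i • inner ℝ (A i) (A k) • A j :=
          Finset.sum_congr rfl fun i _ => by
            simp only [Finset.smul_sum, gram_inv_symm A i, smul_comm (inner ℝ (A i) (A k))]
      _ = ∑ j, inner ℝ (gramDual A j) (A k) • A j := by
          rw [Finset.sum_comm]
          simp only [gramDual, sum_inner, real_inner_smul_left, Finset.sum_smul, smul_smul]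
      _ = A k := by simp [inner_gramDual hA]
  simpa [P] using LinearMap.eqOn_span hP hx

theorem sum_inner_gramDual_smul {A : ι → F} (hA : LinearIndependent ℝ A) {x : F}
    (hx : x ∈ Submodule.span ℝ (Set.range A)) : ∑ i, inner ℝ (gramDual A i) x • A i = x := by
  calc ∑ i, inner ℝ (gramDual A i) x • A i = ∑ j, inner ℝ (A j) x • gramDual A j := by
        simp only [gramDual, sum_inner, real_inner_smul_left, Finset.sum_smul, Finset.smul_sum,
          smul_smul]
        rw [Finset.sum_comm]
        simp only [gram_inv_symm A, mul_comm]
    _ = x := sum_inner_smul_gramDual hA hx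

theorem sum_smul_gramDual_orthogonal_iff {κ : Type*} {A : ι → F} (hA : LinearIndependent ℝ A)
    {w : κ → F} (hw : Submodule.span ℝ (Set.range w) = Submodule.span ℝ (Set.range A)) (c : ι → ℝ) :
    (∀ j, inner ℝ (w j) (∑ i, c i • gramDual A i) = 0) ↔ ∀ i, c i = 0 := by
  refine ⟨fun h i => ?_, fun h j => by simp [h]⟩
  have hle : Submodule.span ℝ (Set.range w) ≤ (innerₗ F (∑ i, c i • gramDual A i)).ker :=
    Submodule.span_le.2 (by rintro _ ⟨j, rfl⟩; exact (real_inner_comm _ _).trans (h j))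
  have hAi : inner ℝ (∑ i, c i • gramDual A i) (A i) = 0 :=
    hle (hw ▸ Submodule.subset_span ⟨i, rfl⟩)
  simpa [sum_inner, real_inner_smul_left, inner_gramDual hA] using hAi

theorem sum_stdOrthonormalBasis_eq_sum_gramDual {A : ι → F} (hA : LinearIndependent ℝ A)
    {T : Submodule ℝ F} [FiniteDimensional ℝ T] (hT : Submodule.span ℝ (Set.range A) = T)
    (B : F →ₗ[ℝ] F →ₗ[ℝ] W) :
    ∑ k, B (stdOrthonormalBasis ℝ T k) (stdOrthonormalBasis ℝ T k) =
      ∑ i, B (A i) (gramDual A i) := by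
  let e := stdOrthonormalBasis ℝ T
  have hA_mem (i : ι) : A i ∈ T := hT ▸ Submodule.subset_span ⟨i, rfl⟩
  have hA_eq (i : ι) : ∑ k, inner ℝ (A i) (e k) • (e k : F) = A i := by
    have h := congrArg Subtype.val (e.sum_repr' ⟨A i, hA_mem i⟩)
    rw [Submodule.coe_sum] at h
    simpa [real_inner_comm] using h
  calc ∑ k, B (e k) (e k)
      = ∑ k, ∑ i, inner ℝ (A i) (e k : F) • B (e k) (gramDual A i) :=
        Finset.sum_congr rfl fun k _ => by
          have he := sum_inner_smul_gramDual hA (hT.ge (e k).2)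
          simpa using congrArg (B (e k)) he.symm
    _ = ∑ i, B (A i) (gramDual A i) := by
        rw [Finset.sum_comm]
        refine Finset.sum_congr rfl fun i _ => ?_
        conv_rhs => rw [← hA_eq i]
        simp only [map_sum, map_smul, LinearMap.sum_apply, LinearMap.smul_apply]

end GramDual

section Jacobi

variable {ι F : Type*} [Fintype ι] [DecidableEq ι] [NormedAddCommGroup F] [InnerProductSpace ℝ F]

theorem hasDerivAt_det_one_add_smul (H : Matrix ι ι ℝ) :
    HasDerivAt (fun t : ℝ => (1 + t • H).det) H.trace 0 := by
  rw [funext (det_one_add_smul · H)]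
  refine ((((hasDerivAt_id 0).const_mul H.trace).const_add 1).add
    ((Polynomial.hasDerivAt _ 0).mul (hasDerivAt_pow 2 0))).congr_deriv ?_
  simp

theorem differentiable_det : Differentiable ℝ fun A : ι → ι → ℝ => (of A).det := by
  simp only [det_apply, of_apply]
  fun_prop

theorem hasDerivAt_det {G : ℝ → Matrix ι ι ℝ} {G' : Matrix ι ι ℝ} {t : ℝ}
    (hG : ∀ i j, HasDerivAt (fun s => G s i j) (G' i j) t) (hdet : (G t).det ≠ 0) :
    HasDerivAt (fun s => (G s).det) ((G t).det * ((G t)⁻¹ * G').trace) t := by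
  have hG_curve : HasDerivAt (fun s i j => G s i j) (fun i j => G' i j) t :=
    hasDerivAt_pi.2 fun i => hasDerivAt_pi.2 fun j => hG i j
  have hG_line : HasDerivAt (fun s i j => G t i j + s * G' i j) (fun i j => G' i j) 0 :=
    hasDerivAt_pi.2 fun i => hasDerivAt_pi.2 fun j => by
      simpa using ((hasDerivAt_id (0 : ℝ)).mul_const (G' i j)).const_add (G t i j)
  have hcurve := (differentiable_det _).hasFDerivAt.comp_hasDerivAt t hG_curve
  have hline := (differentiable_det _).hasFDerivAt.comp_hasDerivAt 0 hG_line
  have hline' := (hasDerivAt_det_one_add_smul ((G t)⁻¹ * G')).const_mul (G t).det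
  have heq (s : ℝ) : (G t).det * (1 + s • ((G t)⁻¹ * G')).det =
      (of fun i j => G t i j + s * G' i j).det := by
    rw [← det_mul, mul_add, mul_one, mul_smul_comm, ← mul_assoc, mul_nonsing_inv _ hdet.isUnit,
      one_mul]
    rfl
  simp_rw [heq] at hline'
  simp only [zero_mul, add_zero] at hline
  exact hcurve.congr_deriv (hline.unique hline')

theorem hasDerivAt_sqrt_det_gram {A : ℝ → ι → F} {A' : ι → F} {t : ℝ}
    (hA : ∀ i, HasDerivAt (fun s => A s i) (A' i) t) (hlin : LinearIndependent ℝ (A t)) :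
    HasDerivAt (fun s => √(gram ℝ (A s)).det)
      (√(gram ℝ (A t)).det * ∑ i, inner ℝ (gramDual (A t) i) (A' i)) t := by
  have hpos := det_gram_pos hlin
  let G' : Matrix ι ι ℝ := of fun i j => inner ℝ (A t i) (A' j) + inner ℝ (A' i) (A t j)
  have hG (i j : ι) : HasDerivAt (fun s => gram ℝ (A s) i j) (G' i j) t :=
    (hA i).inner ℝ (hA j)
  have htrace : ((gram ℝ (A t))⁻¹ * G').trace = 2 * ∑ i, inner ℝ (gramDual (A t) i) (A' i) := by
    have hsymm : ∑ i, ∑ j, (gram ℝ (A t))⁻¹ i j * inner ℝ (A' j) (A t i) =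
        ∑ i, ∑ j, (gram ℝ (A t))⁻¹ i j * inner ℝ (A t j) (A' i) := by
      rw [Finset.sum_comm]
      simp only [gram_inv_symm (A t), real_inner_comm]
    simp only [trace, diag_apply, mul_apply, G', of_apply, mul_add, Finset.sum_add_distrib, hsymm,
      gramDual, sum_inner, real_inner_smul_left, two_mul]
  refine ((hasDerivAt_det hG hpos.ne').sqrt hpos.ne').congr_deriv ?_
  have hsqrt := Real.mul_self_sqrt hpos.le
  rw [htrace, div_eq_iff (mul_ne_zero two_ne_zero (Real.sqrt_pos.2 hpos).ne')]
  linear_combination (-2 * ∑ i, inner ℝ (gramDual (A t) i) (A' i)) * hsqrt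

end Jacobi

section Smooth

variable {X ι F : Type*} [NormedAddCommGroup X] [NormedSpace ℝ X] [Fintype ι] [DecidableEq ι]
  [NormedAddCommGroup F] [InnerProductSpace ℝ F] {k : ℕ∞ω} {s : Set X}

theorem contDiffOn_det {G : X → Matrix ι ι ℝ} (hG : ∀ i j, ContDiffOn ℝ k (fun x => G x i j) s) :
    ContDiffOn ℝ k (fun x => (G x).det) s := by
  simp_rw [det_apply]
  exact ContDiffOn.sum fun σ _ => (contDiffOn_prod fun i _ => hG _ _).const_smul _

theorem contDiffOn_inv {G : X → Matrix ι ι ℝ} (hG : ∀ i j, ContDiffOn ℝ k (fun x => G x i j) s)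
    (hdet : ∀ x ∈ s, (G x).det ≠ 0) (i j : ι) : ContDiffOn ℝ k (fun x => (G x)⁻¹ i j) s := by
  have hcramer (x : X) :
      (G x)⁻¹ i j = ((G x).det)⁻¹ * ((G x).updateRow j (Pi.single i 1)).det := by
    rw [inv_def, Matrix.smul_apply, adjugate_apply, Ring.inverse_eq_inv', smul_eq_mul]
  simp_rw [hcramer]
  refine ((contDiffOn_det hG).inv hdet).mul (contDiffOn_det fun a b => ?_)
  simp_rw [updateRow_apply]
  split_ifs
  · exact contDiffOn_const
  · exact hG _ _

variable {A : X → ι → F}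

theorem contDiffOn_sqrt_det_gram (hA : ∀ i, ContDiffOn ℝ k (fun x => A x i) s)
    (hlin : ∀ x ∈ s, LinearIndependent ℝ (A x)) :
    ContDiffOn ℝ k (fun x => √(gram ℝ (A x)).det) s :=
  (contDiffOn_det fun i j => (hA i).inner ℝ (hA j)).sqrt fun x hx => (det_gram_pos (hlin x hx)).ne'

theorem contDiffOn_gramDual (hA : ∀ i, ContDiffOn ℝ k (fun x => A x i) s)
    (hlin : ∀ x ∈ s, LinearIndependent ℝ (A x)) (i : ι) :
    ContDiffOn ℝ k (fun x => gramDual (A x) i) s :=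
  ContDiffOn.sum fun j _ => (contDiffOn_inv (fun i j => (hA i).inner ℝ (hA j))
    (fun x hx => (det_gram_pos (hlin x hx)).ne') i j).smul (hA j)

end Smooth

end

/-! ### The area formula -/

section

open Module Matrix MeasureTheory Filter Topology
open scoped ENNReal NNReal

section LocalComparison

theorem exists_nhds_norm_sub_le {X Y : Type*} [NormedAddCommGroup X] [NormedSpace ℝ X]
    [NormedAddCommGroup Y] [NormedSpace ℝ Y] {f : X → Y} {L : X →L[ℝ] Y} {x₀ : X}
    (hf : HasStrictFDerivAt f L x₀) {K : ℝ≥0} (hL : AntilipschitzWith K L) {ε : ℝ} (hε : 0 < ε) :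
    ∃ s ∈ 𝓝 x₀, ∀ x ∈ s, ∀ y ∈ s, ‖f x - f y - (L x - L y)‖ ≤ ε * ‖L x - L y‖ := by
  have hO : (fun p : X × X => p.1 - p.2) =O[𝓝 (x₀, x₀)] fun p => L p.1 - L p.2 :=
    Asymptotics.IsBigO.of_bound K <| Eventually.of_forall fun p => by
      simpa only [dist_eq_norm] using hL.le_mul_dist p.1 p.2
  have hev := (hf.isLittleO.trans_isBigO hO).def hε
  rw [nhds_prod_eq] at hev
  obtain ⟨s, hs, h⟩ := eventually_prod_self_iff'.1 hev
  exact ⟨s, hs, fun x hx y hy => by simpa only [map_sub] using h x hx y hy⟩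

theorem exists_nhds_dist_comparison {X Y : Type*} [NormedAddCommGroup X] [NormedSpace ℝ X]
    [NormedAddCommGroup Y] [NormedSpace ℝ Y] {f : X → Y} {L : X →L[ℝ] Y} {x₀ : X}
    (hf : HasStrictFDerivAt f L x₀) {K : ℝ≥0} (hL : AntilipschitzWith K L) {r : ℝ≥0} (hr : 1 < r) :
    ∃ s ∈ 𝓝 x₀, ∀ x ∈ s, ∀ y ∈ s,
      dist (f x) (f y) ≤ r * dist (L x) (L y) ∧ dist (L x) (L y) ≤ r * dist (f x) (f y) := by
  have hr1 : (1 : ℝ) < r := by exact_mod_cast hr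
  have hr0 : (0 : ℝ) < r := by linarith
  have hinv : (r : ℝ) * (r : ℝ)⁻¹ = 1 := mul_inv_cancel₀ hr0.ne'
  obtain ⟨s, hs, h⟩ := exists_nhds_norm_sub_le hf hL (sub_pos.2 (inv_lt_one_of_one_lt₀ hr1))
  refine ⟨s, hs, fun x hx y hy => ?_⟩
  have hxy := h x hx y hy
  rw [dist_eq_norm, dist_eq_norm]
  constructor
  · calc ‖f x - f y‖ ≤ ‖f x - f y - (L x - L y)‖ + ‖L x - L y‖ := norm_le_norm_sub_add _ _
      _ ≤ (2 - (r : ℝ)⁻¹) * ‖L x - L y‖ := by linarith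
      _ ≤ r * ‖L x - L y‖ := by
        gcongr
        nlinarith [inv_pos.2 hr0, sq_nonneg ((r : ℝ) - 1)]
  · have hle : ‖L x - L y‖ ≤ ‖f x - f y‖ + ‖f x - f y - (L x - L y)‖ := norm_le_insert _ _
    rw [← inv_mul_le_iff₀ hr0]
    linarith

theorem euclideanHausdorffMeasure_image_le_of_dist_le {X Y Z : Type*} [MetricSpace Y]
    [MeasurableSpace Y] [BorelSpace Y] [MetricSpace Z] [MeasurableSpace Z] [BorelSpace Z]
    {f : X → Y} {g : X → Z} {s : Set X} {r : ℝ≥0}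
    (h : ∀ x ∈ s, ∀ y ∈ s, dist (g x) (g y) ≤ r * dist (f x) (f y)) (d : ℕ) :
    μHE[d] (g '' s) ≤ (r : ℝ≥0∞) ^ d * μHE[d] (f '' s) := by
  rcases s.eq_empty_or_nonempty with rfl | ⟨x₀, _⟩
  · simp
  have : Nonempty X := ⟨x₀⟩
  let gInv : Y → Z := g ∘ Function.invFunOn f s
  have hmem (x : X) (hx : x ∈ s) : Function.invFunOn f s (f x) ∈ s :=
    Function.invFunOn_mem ⟨x, hx, rfl⟩
  have hf_inv (x : X) (hx : x ∈ s) : f (Function.invFunOn f s (f x)) = f x :=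
    Function.invFunOn_eq ⟨x, hx, rfl⟩
  have hlip : LipschitzOnWith r gInv (f '' s) := LipschitzOnWith.of_dist_le_mul <| by
    rintro _ ⟨x, hx, rfl⟩ _ ⟨y, hy, rfl⟩
    simpa only [gInv, Function.comp_apply, hf_inv x hx, hf_inv y hy] using
      h _ (hmem x hx) _ (hmem y hy)
  have himage : gInv '' (f '' s) = g '' s := by
    rw [Set.image_image]
    refine Set.image_congr fun x hx => dist_le_zero.1 ?_
    simpa only [gInv, Function.comp_apply, hf_inv x hx, dist_self, mul_zero] using
      h _ (hmem x hx) _ hx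
  have hle := hlip.hausdorffMeasure_image_le (d := d) (Nat.cast_nonneg d)
  rw [himage, ENNReal.rpow_natCast] at hle
  rw [Measure.euclideanHausdorffMeasure_def, Measure.euclideanHausdorffMeasure_def,
    Measure.smul_apply, Measure.smul_apply, mul_smul_comm]
  gcongr

theorem exists_nhds_withDensity_comparison {X : Type*} [TopologicalSpace X] [MeasurableSpace X]
    {μ : Measure X} {g : X → ℝ} {x₀ : X} (hg : ContinuousAt g x₀) (hpos : 0 < g x₀) {r : ℝ≥0}
    (hr : 1 < r) :
    ∃ B ∈ 𝓝 x₀, ∀ A ⊆ B, MeasurableSet A →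
      ENNReal.ofReal (g x₀) * μ A ≤ r * μ.withDensity (fun x => ENNReal.ofReal (g x)) A ∧
      μ.withDensity (fun x => ENNReal.ofReal (g x)) A ≤ r * (ENNReal.ofReal (g x₀) * μ A) := by
  have hr1 : (1 : ℝ) < r := by exact_mod_cast hr
  have hlt : ∀ᶠ x in 𝓝 x₀, g x < r * g x₀ :=
    hg.eventually_lt continuousAt_const (by nlinarith [hr1])
  have hgt : ∀ᶠ x in 𝓝 x₀, g x₀ < r * g x :=
    continuousAt_const.eventually_lt (hg.const_mul _) (by nlinarith [hr1])
  refine ⟨_, hlt.and hgt, fun A hAB hA => ?_⟩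
  rw [withDensity_apply _ hA, ← mul_assoc, ← lintegral_const_mul' _ _ ENNReal.coe_ne_top,
    ← setLIntegral_const, ← setLIntegral_const, ← ENNReal.ofReal_coe_nnreal]
  simp only [← ENNReal.ofReal_mul r.coe_nonneg]
  exact ⟨setLIntegral_mono' hA fun x hx => ENNReal.ofReal_le_ofReal (hAB hx).2.le,
    setLIntegral_mono' hA fun x hx => ENNReal.ofReal_le_ofReal (hAB hx).1.le⟩

theorem restrict_le_restrict_of_locally_le {X : Type*} [TopologicalSpace X]
    [SecondCountableTopology X] [MeasurableSpace X] [OpensMeasurableSpace X] {μ ν : Measure X}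
    {V : Set X} (hV : MeasurableSet V)
    (h : ∀ x ∈ V, ∃ B ∈ 𝓝 x, ∀ A ⊆ B ∩ V, MeasurableSet A → μ A ≤ ν A) :
    μ.restrict V ≤ ν.restrict V := by
  rcases V.eq_empty_or_nonempty with rfl | hne
  · simp
  choose! B hB hle using h
  obtain ⟨t, htV, htc, hcov⟩ := TopologicalSpace.countable_cover_nhdsWithin fun x hx =>
    mem_nhdsWithin_of_mem_nhds (interior_mem_nhds.2 (hB x hx))
  have htne : t.Nonempty := by
    by_contra! rfl
    simpa using hcov hne.some_mem
  obtain ⟨x, rfl⟩ := htc.exists_eq_range htne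
  let D : ℕ → Set X := fun k => disjointed (fun k => interior (B (x k))) k ∩ V
  have hD (k : ℕ) : MeasurableSet (D k) :=
    (MeasurableSet.disjointed (fun k => isOpen_interior.measurableSet) k).inter hV
  have hdisj : Pairwise (Function.onFun Disjoint D) := fun i j hij =>
    ((disjoint_disjointed _) hij).mono Set.inter_subset_left Set.inter_subset_left
  have hDV : ⋃ k, D k = V := by
    rw [← Set.iUnion_inter, iUnion_disjointed, Set.inter_eq_right]
    simpa using hcov
  have hDB (k : ℕ) : D k ⊆ B (x k) ∩ V :=
    Set.inter_subset_inter_left _ ((disjointed_subset _ _).trans interior_subset)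
  rw [← hDV, Measure.restrict_iUnion hdisj hD, Measure.restrict_iUnion hdisj hD, Measure.le_iff]
  intro A hA
  rw [Measure.sum_apply _ hA, Measure.sum_apply _ hA]
  refine ENNReal.tsum_le_tsum fun k => ?_
  rw [Measure.restrict_apply hA, Measure.restrict_apply hA]
  exact hle _ (htV ⟨k, rfl⟩) _ (Set.inter_subset_right.trans (hDB k)) (hA.inter (hD k))

theorem le_of_forall_one_lt_le_pow_mul {a b : ℝ≥0∞} (k : ℕ)
    (h : ∀ r : ℝ≥0, 1 < r → a ≤ (r : ℝ≥0∞) ^ k * b) : a ≤ b := by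
  have hpow : Tendsto (fun r : ℝ≥0 => (r : ℝ≥0∞) ^ k) (𝓝[>] 1) (𝓝 1) := by
    have hcont : Continuous fun r : ℝ≥0 => (r : ℝ≥0∞) ^ k :=
      (ENNReal.continuous_pow _).comp ENNReal.continuous_coe
    simpa using (hcont.tendsto 1).mono_left nhdsWithin_le_nhds
  have hmul := ENNReal.Tendsto.mul_const (b := b) hpow (Or.inl one_ne_zero)
  rw [one_mul] at hmul
  exact ge_of_tendsto hmul (eventually_mem_nhdsWithin.mono h)

theorem restrict_le_restrict_of_locally_le_pow_mul {X : Type*} [TopologicalSpace X]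
    [SecondCountableTopology X] [MeasurableSpace X] [OpensMeasurableSpace X] {μ ν : Measure X}
    {V : Set X} (hV : MeasurableSet V) (k : ℕ)
    (h : ∀ r : ℝ≥0, 1 < r → ∀ x ∈ V, ∃ B ∈ 𝓝 x, ∀ A ⊆ B ∩ V, MeasurableSet A →
      μ A ≤ (r : ℝ≥0∞) ^ k * ν A) :
    μ.restrict V ≤ ν.restrict V := by
  refine Measure.le_iff.2 fun A _ => le_of_forall_one_lt_le_pow_mul k fun r hr => ?_
  have hle := restrict_le_restrict_of_locally_le (ν := (r : ℝ≥0∞) ^ k • ν) hV (h r hr) A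
  rwa [Measure.restrict_smul, Measure.smul_apply, smul_eq_mul] at hle

end LocalComparison

end

section

open Module Matrix MeasureTheory Filter Topology
open scoped ENNReal NNReal

variable {m n : ℕ}

/-- A `C²` parametrization `f : V → ℝⁿ` which has a linear left inverse `π`, as a graph has. -/
structure IsParam (V : Set (E m)) (f : E m → E n) (π : E n →L[ℝ] E m) : Prop where
  isOpen : IsOpen V
  contDiffOn : ContDiffOn ℝ 2 f V
  left_inv : ∀ y ∈ V, π (f y) = y

/-- The partial derivative `∂_i f`. -/
def pd {W : Type*} [NormedAddCommGroup W] [NormedSpace ℝ W] (f : E m → W) (i : Fin m) (y : E m) :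
    W :=
  fderiv ℝ f y (EuclideanSpace.single i 1)

/-- The coordinate tangent frame `∂₁f, …, ∂_m f` of a parametrization. -/
def tangentFrame (f : E m → E n) (y : E m) (i : Fin m) : E n := pd f i y

/-- The area density `√(det g)` of `f`, where `g` is the first fundamental form. -/
def jac (f : E m → E n) (y : E m) : ℝ := √(gram ℝ (tangentFrame f y)).det

theorem normDet_fderiv (f : E m → E n) (y : E m) :
    (fderiv ℝ f y : E m →ₗ[ℝ] E n).normDet = jac f y := by
  have h := LinearMap.normDet_sq_eq_det_gram (fderiv ℝ f y : E m →ₗ[ℝ] E n)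
    (EuclideanSpace.basisFun (Fin m) ℝ)
  simp only [EuclideanSpace.basisFun_apply, RCLike.ofReal_real_eq_id, id_eq] at h
  rw [jac, ← Real.sqrt_sq (LinearMap.normDet_nonneg _), h]
  rfl

namespace IsParam

variable {V : Set (E m)} {f : E m → E n} {π : E n →L[ℝ] E m}

theorem contDiffAt (hf : IsParam V f π) {y : E m} (hy : y ∈ V) : ContDiffAt ℝ 2 f y :=
  hf.contDiffOn.contDiffAt (hf.isOpen.mem_nhds hy)

theorem hasStrictFDerivAt (hf : IsParam V f π) {y : E m} (hy : y ∈ V) :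
    HasStrictFDerivAt f (fderiv ℝ f y) y :=
  (hf.contDiffAt hy).hasStrictFDerivAt (by norm_num)

theorem π_fderiv (hf : IsParam V f π) {y : E m} (hy : y ∈ V) (v : E m) :
    π (fderiv ℝ f y v) = v := by
  have hcomp : HasFDerivAt (fun y => π (f y)) (π ∘L fderiv ℝ f y) y :=
    π.hasFDerivAt.comp y (hf.hasStrictFDerivAt hy).hasFDerivAt
  have hid : HasFDerivAt (fun y => π (f y)) (ContinuousLinearMap.id ℝ (E m)) y :=
    (hasFDerivAt_id y).congr_of_eventuallyEq
      (eventually_of_mem (hf.isOpen.mem_nhds hy) hf.left_inv)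
  exact DFunLike.congr_fun (hcomp.unique hid) v

theorem fderiv_injective (hf : IsParam V f π) {y : E m} (hy : y ∈ V) :
    Function.Injective (fderiv ℝ f y) :=
  Function.LeftInverse.injective (hf.π_fderiv hy)

theorem linearIndependent_tangentFrame (hf : IsParam V f π) {y : E m} (hy : y ∈ V) :
    LinearIndependent ℝ (tangentFrame f y) := by
  have h := (EuclideanSpace.basisFun (Fin m) ℝ).toBasis.linearIndependent.map'
    (fderiv ℝ f y : E m →ₗ[ℝ] E n) (LinearMap.ker_eq_bot.2 (hf.fderiv_injective hy))
  have hframe : tangentFrame f y = ⇑(fderiv ℝ f y : E m →ₗ[ℝ] E n) ∘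
      ⇑(EuclideanSpace.basisFun (Fin m) ℝ).toBasis := by
    funext i
    simp [tangentFrame, pd]
  rwa [hframe]

theorem jac_pos (hf : IsParam V f π) {y : E m} (hy : y ∈ V) : 0 < jac f y :=
  Real.sqrt_pos.2 (det_gram_pos (hf.linearIndependent_tangentFrame hy))

theorem contDiffOn_pd (hf : IsParam V f π) (i : Fin m) : ContDiffOn ℝ 1 (pd f i) V :=
  (hf.contDiffOn.fderiv_of_isOpen hf.isOpen (by norm_num)).clm_apply contDiffOn_const

theorem contDiffOn_jac (hf : IsParam V f π) : ContDiffOn ℝ 1 (jac f) V :=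
  contDiffOn_sqrt_det_gram hf.contDiffOn_pd fun _ hy => hf.linearIndependent_tangentFrame hy

theorem exists_nhds_measure_image_comparison (hf : IsParam V f π) {y₀ : E m} (hy₀ : y₀ ∈ V)
    {r : ℝ≥0} (hr : 1 < r) :
    ∃ B ∈ 𝓝 y₀, ∀ A ⊆ B,
      μHE[m] (f '' A) ≤ (r : ℝ≥0∞) ^ m * (ENNReal.ofReal (jac f y₀) * volume A) ∧
      ENNReal.ofReal (jac f y₀) * volume A ≤ (r : ℝ≥0∞) ^ m * μHE[m] (f '' A) := by
  have hanti : AntilipschitzWith ‖π‖₊ (fderiv ℝ f y₀) :=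
    π.lipschitz.to_rightInverse (hf.π_fderiv hy₀)
  obtain ⟨B, hB, hdist⟩ := exists_nhds_dist_comparison (hf.hasStrictFDerivAt hy₀) hanti hr
  refine ⟨B, hB, fun A hA => ?_⟩
  have hlin : μHE[m] (fderiv ℝ f y₀ '' A) = ENNReal.ofReal (jac f y₀) * volume A := by
    have h := LinearMap.euclideanHausdorffMeasure_image_eq_normDet_mul_volume
      (fderiv ℝ f y₀ : E m →ₗ[ℝ] E n) A
    rwa [finrank_euclideanSpace_fin, normDet_fderiv] at h
  rw [← hlin]
  exact ⟨euclideanHausdorffMeasure_image_le_of_dist_le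
      (fun x hx y hy => (hdist x (hA hx) y (hA hy)).1) m,
    euclideanHausdorffMeasure_image_le_of_dist_le
      (fun x hx y hy => (hdist x (hA hx) y (hA hy)).2) m⟩

theorem map_restrict_image_apply (hf : IsParam V f π) {A : Set (E m)} (hA : MeasurableSet A) :
    (μHE[m].restrict (f '' V)).map π A = μHE[m] (f '' (A ∩ V)) := by
  have hπ : Measurable π := π.continuous.measurable
  rw [Measure.map_apply hπ hA, Measure.restrict_apply (hπ hA)]
  congr 1
  ext x
  constructor
  · rintro ⟨hx, y, hy, rfl⟩
    exact ⟨y, ⟨by rwa [Set.mem_preimage, hf.left_inv y hy] at hx, hy⟩, rfl⟩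
  · rintro ⟨y, ⟨hyA, hy⟩, rfl⟩
    exact ⟨by rwa [Set.mem_preimage, hf.left_inv y hy], y, hy, rfl⟩

theorem exists_nhds_map_restrict_image_comparison (hf : IsParam V f π) {y₀ : E m} (hy₀ : y₀ ∈ V)
    {r : ℝ≥0} (hr : 1 < r) :
    ∃ B ∈ 𝓝 y₀, ∀ A ⊆ B ∩ V, MeasurableSet A →
      (μHE[m].restrict (f '' V)).map π A ≤
        (r : ℝ≥0∞) ^ (m + 1) * volume.withDensity (fun y => ENNReal.ofReal (jac f y)) A ∧
      volume.withDensity (fun y => ENNReal.ofReal (jac f y)) A ≤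
        (r : ℝ≥0∞) ^ (m + 1) * (μHE[m].restrict (f '' V)).map π A := by
  obtain ⟨B, hB, himage⟩ := hf.exists_nhds_measure_image_comparison hy₀ hr
  obtain ⟨B', hB', hdensity⟩ := exists_nhds_withDensity_comparison (μ := volume)
    (hf.contDiffOn_jac.continuousOn.continuousAt (hf.isOpen.mem_nhds hy₀)) (hf.jac_pos hy₀) hr
  refine ⟨B ∩ B', inter_mem hB hB', fun A hAB hA => ?_⟩
  obtain ⟨himage_le, hle_image⟩ := himage A fun y hy => (hAB hy).1.1
  obtain ⟨hle_density, hdensity_le⟩ := hdensity A (fun y hy => (hAB hy).1.2) hA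
  rw [hf.map_restrict_image_apply hA, Set.inter_eq_left.2 fun y hy => (hAB hy).2]
  constructor
  · rw [pow_succ, mul_assoc]
    exact himage_le.trans (by gcongr)
  · rw [pow_succ', mul_assoc]
    exact hdensity_le.trans (by gcongr)

theorem map_restrict_image (hf : IsParam V f π) :
    (μHE[m].restrict (f '' V)).map π =
      (volume.withDensity fun y => ENNReal.ofReal (jac f y)).restrict V := by
  have hV := hf.isOpen.measurableSet
  have hrestrict : ((μHE[m].restrict (f '' V)).map π).restrict V =
      (μHE[m].restrict (f '' V)).map π := by
    ext A hA
    rw [Measure.restrict_apply hA, hf.map_restrict_image_apply (hA.inter hV),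
      hf.map_restrict_image_apply hA, Set.inter_assoc, Set.inter_self]
  rw [← hrestrict]
  apply le_antisymm <;>
    refine restrict_le_restrict_of_locally_le_pow_mul hV (m + 1) fun r hr y hy => ?_ <;>
    obtain ⟨B, hB, hcomp⟩ := hf.exists_nhds_map_restrict_image_comparison hy hr
  · exact ⟨B, hB, fun A hAB hA => (hcomp A hAB hA).1⟩
  · exact ⟨B, hB, fun A hAB hA => (hcomp A hAB hA).2⟩

end IsParam

end

/-! ### The first variation in a chart -/

section

open Module Matrix MeasureTheory Filter Topology

theorem tsupport_indicator_subset {X W : Type*} [TopologicalSpace X] [Zero W] {V K : Set X}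
    {F : X → W} (hK : IsClosed K) (hF : ∀ y ∈ V, y ∉ K → F y = 0) :
    tsupport (V.indicator F) ⊆ K := by
  refine closure_minimal (fun y hy => ?_) hK
  by_contra hyK
  exact hy (Set.indicator_apply_eq_zero.2 fun hyV => hF y hyV hyK)

theorem contDiff_indicator {X W : Type*} [NormedAddCommGroup X] [NormedSpace ℝ X]
    [NormedAddCommGroup W] [NormedSpace ℝ W] {V K : Set X} {F : X → W} {k : ℕ∞ω} (hV : IsOpen V)
    (hK : IsClosed K) (hKV : K ⊆ V) (hF : ContDiffOn ℝ k F V) (hF0 : ∀ y ∈ V, y ∉ K → F y = 0) :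
    ContDiff ℝ k (V.indicator F) := by
  refine contDiff_iff_contDiffAt.2 fun y => ?_
  by_cases hyV : y ∈ V
  · exact (hF.contDiffAt (hV.mem_nhds hyV)).congr_of_eventuallyEq
      (Set.eqOn_indicator.eventuallyEq_of_mem (hV.mem_nhds hyV))
  · have hy : y ∉ tsupport (V.indicator F) :=
      fun h => hyV (hKV (tsupport_indicator_subset hK hF0 h))
    exact contDiffAt_const.congr_of_eventuallyEq (notMem_tsupport_iff_eventuallyEq.1 hy)

variable {m n : ℕ}

theorem pd_congr {W : Type*} [NormedAddCommGroup W] [NormedSpace ℝ W] {f g : E m → W} {y : E m}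
    (h : f =ᶠ[𝓝 y] g) (j : Fin m) : pd f j y = pd g j y := by
  rw [pd, pd, h.fderiv_eq]

theorem pd_inner {f g : E m → E n} {y : E m} (hf : DifferentiableAt ℝ f y)
    (hg : DifferentiableAt ℝ g y) (j : Fin m) :
    pd (fun y => inner ℝ (f y) (g y)) j y =
      inner ℝ (f y) (pd g j y) + inner ℝ (pd f j y) (g y) :=
  fderiv_inner_apply ℝ hf hg _

theorem integrable_pd {F : E m → ℝ} (hF : ContDiff ℝ 1 F) (hcomp : HasCompactSupport F)
    (j : Fin m) : Integrable (pd F j) :=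
  ((hF.continuous_fderiv (by norm_num)).clm_apply
    continuous_const).integrable_of_hasCompactSupport (hcomp.fderiv_apply ℝ _)

theorem integral_pd_eq_zero {F : E m → ℝ} (hF : ContDiff ℝ 1 F) (hcomp : HasCompactSupport F)
    (j : Fin m) : ∫ y, pd F j y = 0 := by
  have h := integral_mul_fderiv_eq_neg_fderiv_mul_of_integrable (μ := (volume : Measure (E m)))
    (f := fun _ => (1 : ℝ)) (g := F) (v := EuclideanSpace.single j 1) (by simp)
    (by simpa only [one_mul, pd] using! integrable_pd hF hcomp j)
    (by simpa using hF.continuous.integrable_of_hasCompactSupport hcomp) (by fun_prop)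
    (fun y _ => hF.differentiable (by norm_num) y)
  simpa [pd] using h

theorem setIntegral_pd_eq_zero {V K : Set (E m)} (hV : IsOpen V) (hK : IsCompact K) (hKV : K ⊆ V)
    {F : E m → ℝ} (hF : ContDiffOn ℝ 1 F V) (hF0 : ∀ y ∈ V, y ∉ K → F y = 0) (j : Fin m) :
    IntegrableOn (pd F j) V ∧ ∫ y in V, pd F j y = 0 := by
  have hsmooth := contDiff_indicator hV hK.isClosed hKV hF hF0
  have htsupp := tsupport_indicator_subset hK.isClosed hF0
  have hcomp : HasCompactSupport (V.indicator F) :=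
    hK.of_isClosed_subset (isClosed_tsupport _) htsupp
  have hpd : Set.EqOn (pd (V.indicator F) j) (pd F j) V := fun y hy =>
    pd_congr (Set.eqOn_indicator.eventuallyEq_of_mem (hV.mem_nhds hy)) j
  have hpd_compl (y : E m) (hy : y ∉ V) : pd (V.indicator F) j y = 0 := by
    have h := notMem_tsupport_iff_eventuallyEq.1 fun h => hy (hKV (htsupp h))
    simp [pd, h.fderiv_eq]
  refine ⟨(integrable_pd hsmooth hcomp j).integrableOn.congr_fun hpd hV.measurableSet, ?_⟩
  rw [← setIntegral_congr_fun hV.measurableSet hpd,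
    setIntegral_eq_integral_of_forall_compl_eq_zero hpd_compl, integral_pd_eq_zero hsmooth hcomp]

/-- The dual frame of the coordinate tangent frame, weighted by the area density. -/
def coframe (f : E m → E n) (j : Fin m) (y : E m) : E n := jac f y • gramDual (tangentFrame f y) j

/-- The Laplace–Beltrami operator `∑ⱼ ∂ⱼ (√g ∑ᵢ g^{ji} ∂ᵢ f)` of the induced metric applied to the
parametrization itself; the usual factor `1 / √g` is omitted. -/
def laplacian (f : E m → E n) (y : E m) : E n := ∑ j, pd (coframe f j) j y

namespace IsParam

variable {V : Set (E m)} {f : E m → E n} {π : E n →L[ℝ] E m}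

theorem contDiffOn_coframe (hf : IsParam V f π) (j : Fin m) : ContDiffOn ℝ 1 (coframe f j) V :=
  hf.contDiffOn_jac.smul (contDiffOn_gramDual hf.contDiffOn_pd
    (fun _ hy => hf.linearIndependent_tangentFrame hy) j)

theorem differentiableAt (hf : IsParam V f π) {W : Type*} [NormedAddCommGroup W] [NormedSpace ℝ W]
    {g : E m → W} (hg : ContDiffOn ℝ 1 g V) {y : E m} (hy : y ∈ V) : DifferentiableAt ℝ g y :=
  (hg.contDiffAt (hf.isOpen.mem_nhds hy)).differentiableAt (by norm_num)

theorem continuousOn_laplacian (hf : IsParam V f π) : ContinuousOn (laplacian f) V :=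
  continuousOn_finsetSum _ fun j _ =>
    ((hf.contDiffOn_coframe j).continuousOn_fderiv_of_isOpen hf.isOpen (by norm_num)).clm_apply
      continuousOn_const

theorem integral_coframe_add_laplacian (hf : IsParam V f π) {K : Set (E m)} (hK : IsCompact K)
    (hKV : K ⊆ V) {Φ : E m → E n} (hΦ : ContDiffOn ℝ 1 Φ V) (hΦ0 : ∀ y ∈ V, y ∉ K → Φ y = 0) :
    ∫ y in V, ((∑ j, inner ℝ (coframe f j y) (pd Φ j y)) + inner ℝ (laplacian f y) (Φ y)) = 0 := by
  have h (j : Fin m) := setIntegral_pd_eq_zero hf.isOpen hK hKV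
    ((hf.contDiffOn_coframe j).inner ℝ hΦ)
    (fun y hy hyK => by rw [hΦ0 y hy hyK, inner_zero_right]) j
  have hsum : ∫ y in V, ∑ j, pd (fun y => inner ℝ (coframe f j y) (Φ y)) j y = 0 := by
    rw [integral_finsetSum _ fun j _ => (h j).1, Finset.sum_eq_zero fun j _ => (h j).2]
  rw [← hsum]
  refine setIntegral_congr_fun hf.isOpen.measurableSet fun y hy => ?_
  simp only [laplacian, sum_inner, ← Finset.sum_add_distrib]
  exact Finset.sum_congr rfl fun j _ =>
    (pd_inner (hf.differentiableAt (hf.contDiffOn_coframe j) hy) (hf.differentiableAt hΦ hy) j).symm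

theorem inner_coframe_pd (hf : IsParam V f π) {y : E m} (hy : y ∈ V) (j k : Fin m) :
    inner ℝ (coframe f j y) (pd f k y) = if j = k then jac f y else 0 := by
  have h := inner_gramDual (hf.linearIndependent_tangentFrame hy) j k
  rw [tangentFrame] at h
  rw [coframe, real_inner_smul_left, h, mul_ite, mul_one, mul_zero]

theorem pd_pd_comm (hf : IsParam V f π) {y : E m} (hy : y ∈ V) (j k : Fin m) :
    pd (pd f j) k y = pd (pd f k) j y := by
  have hfderiv : DifferentiableAt ℝ (fderiv ℝ f) y :=
    ((hf.contDiffAt hy).fderiv_right (m := 1) (by norm_num)).differentiableAt (by norm_num)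
  have h (j k : Fin m) : pd (pd f j) k y = fderiv ℝ (fderiv ℝ f) y (EuclideanSpace.single k 1)
      (EuclideanSpace.single j 1) := by
    change fderiv ℝ (fun y => fderiv ℝ f y (EuclideanSpace.single j 1)) y _ = _
    simp [fderiv_clm_apply hfderiv (differentiableAt_const _)]
  rw [h, h]
  exact (hf.contDiffAt hy).isSymmSndFDerivAt (by simp) _ _

theorem pd_jac (hf : IsParam V f π) {y : E m} (hy : y ∈ V) (k : Fin m) :
    pd (jac f) k y = ∑ j, inner ℝ (coframe f j y) (pd (pd f j) k y) := by
  have hline {W : Type} [NormedAddCommGroup W] [NormedSpace ℝ W] {g : E m → W}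
      (hg : ContDiffOn ℝ 1 g V) :
      HasDerivAt (fun s : ℝ => g (y + s • EuclideanSpace.single k 1)) (pd g k y) 0 :=
    (hf.differentiableAt hg hy).hasFDerivAt.hasLineDerivAt _
  have hlin : LinearIndependent ℝ
      (tangentFrame f (y + (0 : ℝ) • EuclideanSpace.single k (1 : ℝ))) := by
    simpa using hf.linearIndependent_tangentFrame hy
  have h := hasDerivAt_sqrt_det_gram (fun i => hline (hf.contDiffOn_pd i)) hlin
  rw [zero_smul, add_zero] at h
  rw [(hline hf.contDiffOn_jac).unique h, Finset.mul_sum]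
  simp only [coframe, real_inner_smul_left]
  rfl

theorem inner_laplacian_pd (hf : IsParam V f π) {y : E m} (hy : y ∈ V) (k : Fin m) :
    inner ℝ (laplacian f y) (pd f k y) = 0 := by
  have h (j : Fin m) : inner ℝ (pd (coframe f j) j y) (pd f k y) =
      (if j = k then pd (jac f) k y else 0) - inner ℝ (coframe f j y) (pd (pd f j) k y) := by
    have hpd := pd_inner (hf.differentiableAt (hf.contDiffOn_coframe j) hy)
      (hf.differentiableAt (hf.contDiffOn_pd k) hy) j
    have hdual : (fun y => inner ℝ (coframe f j y) (pd f k y)) =ᶠ[𝓝 y]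
        fun y => if j = k then jac f y else 0 :=
      eventually_of_mem (hf.isOpen.mem_nhds hy) fun z hz => hf.inner_coframe_pd hz j k
    rw [pd_congr hdual, hf.pd_pd_comm hy k j] at hpd
    rw [eq_sub_iff_add_eq', ← hpd]
    split_ifs with hjk
    · rw [hjk]
    · simp [pd]
  rw [laplacian, sum_inner, Finset.sum_congr rfl fun j _ => h j, Finset.sum_sub_distrib,
    ← hf.pd_jac hy]
  simp

theorem eventually_fderiv_comp_coframe_eq_zero (hf : IsParam V f π) {y : E m} (hy : y ∈ V)
    {ρ : E n → ℝ} (hρ : ContDiffAt ℝ 1 ρ (f y)) (h0 : ∀ᶠ z in 𝓝 y, ρ (f z) = 0) (j : Fin m) :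
    (fun z => fderiv ℝ ρ (f z) (coframe f j z)) =ᶠ[𝓝 y] fun _ => 0 := by
  have hρ_diff : ∀ᶠ z in 𝓝 y, DifferentiableAt ℝ ρ (f z) :=
    (hf.contDiffAt hy).continuousAt.eventually
      ((hρ.eventually (by norm_num)).mono fun z hz => hz.differentiableAt (by norm_num))
  filter_upwards [hρ_diff, hf.isOpen.mem_nhds hy, h0.eventually_nhds] with z hz hzV hz0
  have hcomp : HasFDerivAt (fun z => ρ (f z)) (fderiv ℝ ρ (f z) ∘L fderiv ℝ f z) z :=
    hz.hasFDerivAt.comp z (hf.hasStrictFDerivAt hzV).hasFDerivAt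
  have hzero : HasFDerivAt (fun z => ρ (f z)) (0 : E m →L[ℝ] ℝ) z :=
    (hasFDerivAt_const (0 : ℝ) z).congr_of_eventuallyEq hz0
  have htangent (i : Fin m) : fderiv ℝ ρ (f z) (tangentFrame f z i) = 0 :=
    DFunLike.congr_fun (hcomp.unique hzero) _
  simp [coframe, gramDual, htangent]

theorem fderiv_laplacian (hf : IsParam V f π) {y : E m} (hy : y ∈ V) {ρ : E n → ℝ}
    (hρ : ContDiffAt ℝ 2 ρ (f y)) (h0 : ∀ᶠ z in 𝓝 y, ρ (f z) = 0) :
    fderiv ℝ ρ (f y) (laplacian f y) =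
      -∑ j, fderiv ℝ (fderiv ℝ ρ) (f y) (pd f j y) (coframe f j y) := by
  have hcomp : HasFDerivAt (fun z => fderiv ℝ ρ (f z))
      (fderiv ℝ (fderiv ℝ ρ) (f y) ∘L fderiv ℝ f y) y :=
    ((hρ.fderiv_right (m := 1) (by norm_num)).differentiableAt (by norm_num)).hasFDerivAt.comp y
      (hf.hasStrictFDerivAt hy).hasFDerivAt
  rw [laplacian, map_sum, ← Finset.sum_neg_distrib]
  refine Finset.sum_congr rfl fun j _ => eq_neg_of_add_eq_zero_left ?_
  have h := pd_congr (hf.eventually_fderiv_comp_coframe_eq_zero hy (hρ.of_le (by norm_num)) h0 j) j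
  rw [pd, fderiv_clm_apply hcomp.differentiableAt
    (hf.differentiableAt (hf.contDiffOn_coframe j) hy), hcomp.fderiv] at h
  simpa [pd] using h

end IsParam

end

/-! ### Charts of a submanifold -/

section

open Module Matrix MeasureTheory Filter Topology
open TopologicalSpace (Opens)

variable {m n : ℕ}

/-- A parametrization `f : V → M ∩ U` of an open piece of `M`. -/
structure IsChart (M U : Set (E n)) (V : Set (E m)) (f : E m → E n) (π : E n →L[ℝ] E m) : Prop
    extends IsParam V f π where
  isOpen_domain : IsOpen U
  image_eq : f '' V = M ∩ U

theorem finrank_ker_pi_add_card {κ F : Type*} [Fintype κ] [NormedAddCommGroup F] [NormedSpace ℝ F]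
    [FiniteDimensional ℝ F] {ℓ : κ → F →L[ℝ] ℝ} (hℓ : LinearIndependent ℝ ℓ) :
    finrank ℝ (ContinuousLinearMap.pi ℓ).ker + Fintype.card κ = finrank ℝ F := by
  let ℓ' : κ → Dual ℝ F := fun j => ℓ j
  have hℓ' : LinearIndependent ℝ ℓ' :=
    hℓ.map' (ContinuousLinearMap.coeLM ℝ) (LinearMap.ker_eq_bot.2 ContinuousLinearMap.coe_injective)
  have hker : (ContinuousLinearMap.pi ℓ).ker =
      (Submodule.span ℝ (Set.range ℓ')).dualCoannihilator := by
    ext v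
    simp only [LinearMap.mem_ker, funext_iff, Submodule.mem_dualCoannihilator]
    refine ⟨fun hv φ hφ => ?_, fun hv j => hv _ (Submodule.subset_span ⟨j, rfl⟩)⟩
    have hle : Submodule.span ℝ (Set.range ℓ') ≤ (Dual.eval ℝ F v).ker :=
      Submodule.span_le.2 (by rintro _ ⟨j, rfl⟩; exact hv j)
    exact hle hφ
  have h := Subspace.finrank_add_finrank_dualCoannihilator_eq (Submodule.span ℝ (Set.range ℓ'))
  rwa [finrank_span_eq_card hℓ', ← hker, add_comm] at h

theorem exists_continuousLinearEquiv_prod_pi {κ : Type*} [Fintype κ] (hκ : m + Fintype.card κ = n)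
    {ℓ : κ → E n →L[ℝ] ℝ} (hℓ : LinearIndependent ℝ ℓ) :
    ∃ (π : E n →L[ℝ] E m) (D : E n ≃L[ℝ] E m × (κ → ℝ)),
      (D : E n →L[ℝ] E m × (κ → ℝ)) = π.prod (ContinuousLinearMap.pi ℓ) := by
  let K : Submodule ℝ (E n) := (ContinuousLinearMap.pi ℓ).ker
  have hK : finrank ℝ K = m := Nat.add_right_cancel
    ((finrank_ker_pi_add_card hℓ).trans (finrank_euclideanSpace_fin.trans hκ.symm))
  let φ : K ≃ₗᵢ[ℝ] E m := ((stdOrthonormalBasis ℝ K).reindex (finCongr hK)).repr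
  let π : E n →L[ℝ] E m := (φ.toContinuousLinearEquiv : K →L[ℝ] E m) ∘L K.orthogonalProjectionOnto
  have hinj : Function.Injective (π.prod (ContinuousLinearMap.pi ℓ)) := by
    refine (injective_iff_map_eq_zero _).2 fun w hw => ?_
    have hwK : w ∈ K := congrArg Prod.snd hw
    have hπw : π w = 0 := congrArg Prod.fst hw
    have hproj : K.orthogonalProjectionOnto w = 0 := φ.toContinuousLinearEquiv.map_eq_zero_iff.1 hπw
    rw [K.orthogonalProjectionOnto_mem_subspace_eq_self ⟨w, hwK⟩] at hproj
    exact congrArg Subtype.val hproj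
  have hfinrank : finrank ℝ (E n) = finrank ℝ (E m × (κ → ℝ)) := by simp [hκ]
  exact ⟨π, (LinearEquiv.ofInjectiveOfFinrankEq (π.prod (ContinuousLinearMap.pi ℓ)).toLinearMap hinj
    hfinrank).toContinuousLinearEquiv, rfl⟩

theorem isChart_of_openPartialHomeomorph {W : Type*} [NormedAddCommGroup W] [NormedSpace ℝ W]
    {M : Set (E n)} {π : E n →L[ℝ] E m} {e : OpenPartialHomeomorph (E n) (E m × W)}
    (he : ContDiffOn ℝ 2 e.symm e.target) (hπ : ∀ x, (e x).1 = π x)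
    (hM : M ∩ e.source = {x ∈ e.source | (e x).2 = 0}) :
    IsChart M e.source ((·, 0) ⁻¹' e.target) (fun y => e.symm (y, 0)) π where
  isOpen := e.open_target.preimage (by fun_prop)
  contDiffOn := he.comp (contDiff_id.prodMk contDiff_const).contDiffOn fun _ hy => hy
  left_inv y hy := by rw [← hπ, e.right_inv hy]
  isOpen_domain := e.open_source
  image_eq := by
    rw [hM]
    ext x
    constructor
    · rintro ⟨y, hy, rfl⟩
      exact ⟨e.map_target hy, by rw [e.right_inv hy]⟩
    · rintro ⟨hx, hx0⟩
      have hex : (π x, 0) = e x := Prod.ext (hπ x).symm hx0.symm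
      refine ⟨π x, ?_, ?_⟩
      · rw [Set.mem_preimage, hex]
        exact e.map_source hx
      · simp only [hex, e.left_inv hx]

theorem IsSubmanifold.exists_isChart {Ω : Opens (E n)} {M : Set (E n)} (hM : IsSubmanifold m Ω M)
    (hmn : m ≤ n) {a : E n} (ha : a ∈ M) :
    ∃ (U : Set (E n)) (V : Set (E m)) (f : E m → E n) (π : E n →L[ℝ] E m),
      a ∈ U ∧ U ⊆ Ω ∧ IsChart M U V f π := by
  obtain ⟨U₀, ρ, hU₀, haU₀, hρ, hMU₀, hind⟩ := hM.exists_defining a ha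
  have hρ_a (j : Fin (n - m)) : ContDiffAt ℝ ∞ (ρ j) a := (hρ j).contDiffAt (hU₀.mem_nhds haU₀)
  obtain ⟨π, D, hD⟩ := exists_continuousLinearEquiv_prod_pi
    (show m + Fintype.card (Fin (n - m)) = n by simp [hmn]) (hind a ⟨ha, haU₀⟩)
  let Ψ : E n → E m × (Fin (n - m) → ℝ) := fun x => (π x, fun j => ρ j x)
  have hΨ : ContDiffAt ℝ 2 Ψ a := π.contDiff.contDiffAt.prodMk
    (contDiffAt_pi.2 fun j => (hρ_a j).of_le (WithTop.coe_le_coe.2 le_top))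
  have hΨD : HasFDerivAt Ψ (D : E n →L[ℝ] E m × (Fin (n - m) → ℝ)) a := hD ▸
    π.hasFDerivAt.prodMk
      (hasFDerivAt_pi.2 fun j => ((hρ_a j).differentiableAt (by simp)).hasFDerivAt)
  let e₀ := hΨ.toOpenPartialHomeomorph Ψ hΨD (by norm_num)
  have ha₀ : a ∈ e₀.source := hΨ.mem_toOpenPartialHomeomorph_source hΨD (by norm_num)
  let e := (e₀.restrContDiff ℝ 2 (by simp)).restrOpen (U₀ ∩ Ω) (hU₀.inter Ω.isOpen)
  have hsource (x : E n) (hx : x ∈ e.source) : x ∈ U₀ ∩ Ω := hx.2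
  refine ⟨e.source, _, _, π, ⟨⟨ha₀, hΨ, hΨ.to_localInverse hΨD (by norm_num)⟩, haU₀, hM.subset ha⟩,
    fun x hx => (hsource x hx).2, isChart_of_openPartialHomeomorph ?_ (fun _ => rfl) ?_⟩
  · exact (e₀.contDiffOn_restrContDiff_target (𝕜 := ℝ) (by simp)).mono fun y hy => hy.1
  · ext x
    refine and_comm.trans (and_congr_right fun hx => ?_)
    have hxU : x ∈ U₀ := (hsource x hx).1
    have h : x ∈ M ∩ U₀ ↔ x ∈ {x ∈ U₀ | ∀ j, ρ j x = 0} := by rw [hMU₀]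
    have hex : (e x).2 = fun j => ρ j x := rfl
    simpa [hxU, hex, funext_iff] using h

namespace IsChart

variable {M U : Set (E n)} {V : Set (E m)} {f : E m → E n} {π : E n →L[ℝ] E m}

theorem map_mem (hf : IsChart M U V f π) {y : E m} (hy : y ∈ V) : f y ∈ M ∩ U :=
  hf.image_eq ▸ Set.mem_image_of_mem f hy

theorem right_inv (hf : IsChart M U V f π) {x : E n} (hx : x ∈ M ∩ U) : f (π x) = x := by
  obtain ⟨y, hy, rfl⟩ := hf.image_eq.ge hx
  rw [hf.left_inv y hy]

theorem π_mem (hf : IsChart M U V f π) {x : E n} (hx : x ∈ M ∩ U) : π x ∈ V := by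
  obtain ⟨y, hy, rfl⟩ := hf.image_eq.ge hx
  rwa [hf.left_inv y hy]

theorem fderiv_π_of_mem_tangentConeAt (hf : IsChart M U V f π) {y : E m} (hy : y ∈ V) {v : E n}
    (hv : v ∈ tangentConeAt ℝ M (f y)) : fderiv ℝ f y (π v) = v := by
  rw [← tangentConeAt_inter_nhds (hf.isOpen_domain.mem_nhds (hf.map_mem hy).2)] at hv
  have hdiff : HasFDerivAt (fun x => f (π x) - x)
      (fderiv ℝ f y ∘L π - ContinuousLinearMap.id ℝ (E n)) (f y) := by
    refine (HasFDerivAt.comp (f y) ?_ π.hasFDerivAt).sub (hasFDerivAt_id _)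
    rw [hf.left_inv y hy]
    exact (hf.hasStrictFDerivAt hy).hasFDerivAt
  have hcone : fderiv ℝ f y (π v) - v ∈ tangentConeAt ℝ {0} (f (π (f y)) - f y) :=
    tangentConeAt_mono (by rintro _ ⟨x, hx, rfl⟩; simp [hf.right_inv hx])
      (hdiff.hasFDerivWithinAt.mapsTo_tangent_cone hv)
  rw [hf.left_inv y hy, sub_self] at hcone
  refine sub_eq_zero.1 (tangentConeAt_subset_zero (fun hacc => ?_) hcone)
  obtain ⟨z, ⟨-, hz⟩, hne⟩ := accPt_iff_nhds.1 hacc Set.univ univ_mem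
  exact hne hz

theorem span_tangentFrame (hf : IsChart M U V f π) {y : E m} (hy : y ∈ V) :
    Submodule.span ℝ (Set.range (tangentFrame f y)) = tangentSpace M (f y) := by
  apply le_antisymm
  · rw [Submodule.span_le]
    rintro _ ⟨i, rfl⟩
    have hcone : tangentFrame f y i ∈ tangentConeAt ℝ (f '' V) (f y) :=
      (hf.hasStrictFDerivAt hy).hasFDerivAt.hasFDerivWithinAt.mapsTo_tangent_cone
        (by simp [tangentConeAt_of_mem_nhds (hf.isOpen.mem_nhds hy)])
    rw [hf.image_eq] at hcone
    exact Submodule.subset_span (tangentConeAt_mono Set.inter_subset_left hcone)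
  · rw [tangentSpace, Submodule.span_le]
    intro v hv
    rw [SetLike.mem_coe, ← hf.fderiv_π_of_mem_tangentConeAt hy hv,
      ← (EuclideanSpace.basisFun (Fin m) ℝ).sum_repr (π v), map_sum]
    refine Submodule.sum_mem _ fun i _ => ?_
    rw [map_smul, EuclideanSpace.basisFun_apply]
    exact Submodule.smul_mem _ _ (Submodule.subset_span ⟨i, rfl⟩)

theorem finrank_tangentSpace (hf : IsChart M U V f π) {y : E m} (hy : y ∈ V) :
    finrank ℝ (tangentSpace M (f y)) = m := by
  rw [← hf.span_tangentFrame hy, finrank_span_eq_card (hf.linearIndependent_tangentFrame hy),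
    Fintype.card_fin]

theorem sum_tangentSpace (hf : IsChart M U V f π) {y : E m} (hy : y ∈ V) {W : Type*}
    [AddCommGroup W] [Module ℝ W] (B : E n →ₗ[ℝ] E n →ₗ[ℝ] W) :
    ∑ k, B (stdOrthonormalBasis ℝ (tangentSpace M (f y)) k : E n)
      (stdOrthonormalBasis ℝ (tangentSpace M (f y)) k : E n) =
      ∑ i, B (pd f i y) (gramDual (tangentFrame f y) i) :=
  sum_stdOrthonormalBasis_eq_sum_gramDual (hf.linearIndependent_tangentFrame hy)
    (hf.span_tangentFrame hy) B

end IsChart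

end

/-! ### Orthonormal defining systems -/

section

open Module Matrix MeasureTheory Filter Topology InnerProductSpace
open TopologicalSpace (Opens)

variable {m n : ℕ}

section GramSchmidt

variable {X F κ : Type*} [NormedAddCommGroup X] [NormedSpace ℝ X] [NormedAddCommGroup F]
  [InnerProductSpace ℝ F] [LinearOrder κ] [LocallyFiniteOrderBot κ] [WellFoundedLT κ]
  {k : ℕ∞ω} {s : Set X} {v : X → κ → F}

theorem contDiffOn_gramSchmidt (hv : ∀ j, ContDiffOn ℝ k (fun x => v x j) s)
    (hlin : ∀ x ∈ s, LinearIndependent ℝ (v x)) (j : κ) :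
    ContDiffOn ℝ k (fun x => gramSchmidt ℝ (v x) j) s := by
  induction j using WellFoundedLT.induction with
  | ind j ih =>
    have h : (fun x => gramSchmidt ℝ (v x) j) = fun x => v x j - ∑ i ∈ Finset.Iio j,
        (inner ℝ (gramSchmidt ℝ (v x) i) (v x j) / ‖gramSchmidt ℝ (v x) i‖ ^ 2) •
          gramSchmidt ℝ (v x) i :=
      funext fun x => eq_sub_iff_add_eq.2 (gramSchmidt_def'' ℝ (v x) j).symm
    rw [h]
    refine (hv j).sub (ContDiffOn.sum fun i hi => ?_)
    have hi_smooth := ih i (Finset.mem_Iio.1 hi)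
    exact ((hi_smooth.inner ℝ (hv j)).div (hi_smooth.norm_sq ℝ) fun x hx =>
      pow_ne_zero 2 (norm_ne_zero_iff.2 (gramSchmidt_ne_zero i (hlin x hx)))).smul hi_smooth

theorem contDiffOn_gramSchmidtNormed (hv : ∀ j, ContDiffOn ℝ k (fun x => v x j) s)
    (hlin : ∀ x ∈ s, LinearIndependent ℝ (v x)) (j : κ) :
    ContDiffOn ℝ k (fun x => gramSchmidtNormed ℝ (v x) j) s := by
  have h := contDiffOn_gramSchmidt hv hlin j
  have hne (x) (hx : x ∈ s) := gramSchmidt_ne_zero j (hlin x hx)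
  exact ((h.norm ℝ hne).inv fun x hx => norm_ne_zero_iff.2 (hne x hx)).smul h

end GramSchmidt

section Gradient

variable {F : Type*} [NormedAddCommGroup F] [InnerProductSpace ℝ F] [CompleteSpace F]

theorem linearIndependent_gradient {κ : Type*} {ρ : κ → F → ℝ} {x : F}
    (h : LinearIndependent ℝ fun j => fderiv ℝ (ρ j) x) :
    LinearIndependent ℝ fun j => ∇ (ρ j) x := by
  refine LinearIndependent.of_comp (innerSL ℝ : F →L[ℝ] F →L[ℝ] ℝ).toLinearMap ?_
  convert h with j
  ext u
  exact inner_gradient_left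

theorem contDiffOn_gradient {k : ℕ∞ω} {ρ : F → ℝ} {U : Set F} (hU : IsOpen U)
    (hρ : ContDiffOn ℝ (k + 1) ρ U) : ContDiffOn ℝ k (∇ ρ) U :=
  (toDual ℝ F).symm.contDiff.comp_contDiffOn (hρ.fderiv_of_isOpen hU le_rfl)

variable {κ : Type*} [Fintype κ] [DecidableEq κ] {ρ : κ → F → ℝ} {x : F}

/-- The vector field in the span of the gradients of the `ρ_j` whose inner product with `∇ρ_j` is
`ρ_j`, where these gradients are linearly independent. -/
def gradientLift (ρ : κ → F → ℝ) (x : F) : F := ∑ k, ρ k x • gramDual (fun j => ∇ (ρ j) x) k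

theorem hasFDerivAt_gradientLift (hρ : ∀ k, DifferentiableAt ℝ (ρ k) x)
    (hdual : ∀ k, DifferentiableAt ℝ (fun x => gramDual (fun j => ∇ (ρ j) x) k) x)
    (h0 : ∀ k, ρ k x = 0) :
    HasFDerivAt (gradientLift ρ)
      (∑ k, (fderiv ℝ (ρ k) x).smulRight (gramDual (fun j => ∇ (ρ j) x) k)) x := by
  refine HasFDerivAt.fun_sum fun k _ => ?_
  simpa only [h0 k, zero_smul, zero_add] using
    (hρ k).hasFDerivAt.fun_smul (hdual k).hasFDerivAt

theorem gradient_inner_gradientLift (hlin : LinearIndependent ℝ fun j => ∇ (ρ j) x)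
    (hρ : ∀ k, DifferentiableAt ℝ (ρ k) x)
    (hdual : ∀ k, DifferentiableAt ℝ (fun x => gramDual (fun j => ∇ (ρ j) x) k) x)
    (h0 : ∀ k, ρ k x = 0) {w : F → F} (hw : DifferentiableAt ℝ w x)
    (hw_span : w x ∈ Submodule.span ℝ (Set.range fun j => ∇ (ρ j) x)) :
    ∇ (fun x => inner ℝ (w x) (gradientLift ρ x)) x = w x := by
  have hlift := hasFDerivAt_gradientLift hρ hdual h0
  have hlift0 : gradientLift ρ x = 0 := by simp [gradientLift, h0]
  refine ext_inner_right ℝ fun u => ?_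
  calc inner ℝ (∇ (fun x => inner ℝ (w x) (gradientLift ρ x)) x) u
      = inner ℝ (w x) (∑ k, inner ℝ (∇ (ρ k) x) u • gramDual (fun j => ∇ (ρ j) x) k) := by
        rw [inner_gradient_left, fderiv_inner_apply ℝ hw hlift.differentiableAt, hlift0,
          inner_zero_right, add_zero, hlift.fderiv]
        simp [inner_gradient_left]
    _ = inner ℝ (∑ k, inner ℝ (gramDual (fun j => ∇ (ρ j) x) k) (w x) • ∇ (ρ k) x) u := by
        simp only [inner_sum, sum_inner, real_inner_smul_left, real_inner_smul_right]
        exact Finset.sum_congr rfl fun k _ => by rw [mul_comm, real_inner_comm]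
    _ = inner ℝ (w x) u := by rw [sum_inner_gramDual_smul hlin hw_span]

end Gradient

theorem IsSubmanifold.exists_linearIndependent_gradient {Ω : Opens (E n)} {M : Set (E n)}
    (hM : IsSubmanifold m Ω M) {a : E n} (ha : a ∈ M) :
    ∃ (U : Set (E n)) (ρ : Fin (n - m) → E n → ℝ), IsOpen U ∧ a ∈ U ∧
      (∀ j, ContDiffOn ℝ ∞ (ρ j) U) ∧ M ∩ U = {x ∈ U | ∀ j, ρ j x = 0} ∧
      ∀ x ∈ U, LinearIndependent ℝ (fun j => ∇ (ρ j) x) := by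
  obtain ⟨U, ρ, hU, haU, hρ, hMU, hlin⟩ := hM.exists_defining a ha
  have hgrad (j : Fin (n - m)) : ContDiffOn ℝ ∞ (∇ (ρ j)) U := contDiffOn_gradient hU (hρ j)
  have hdet : ContinuousOn (fun x => (gram ℝ fun j => ∇ (ρ j) x).det) U :=
    (contDiffOn_det fun i j => (hgrad i).inner ℝ (hgrad j)).continuousOn
  refine ⟨U ∩ (fun x => (gram ℝ fun j => ∇ (ρ j) x).det) ⁻¹' {0}ᶜ, ρ,
    hdet.isOpen_inter_preimage hU isOpen_compl_singleton,
    ⟨haU, det_gram_ne_zero_iff_linearIndependent.2 (linearIndependent_gradient (hlin a ⟨ha, haU⟩))⟩,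
    fun j => (hρ j).mono Set.inter_subset_left, ?_,
    fun x hx => det_gram_ne_zero_iff_linearIndependent.1 hx.2⟩
  rw [← Set.inter_assoc, hMU]
  ext x
  simp only [Set.mem_inter_iff, Set.mem_ofPred_eq]
  tauto

theorem IsSubmanifold.exists_isOrthonormalDefiningSystem {Ω : Opens (E n)} {M : Set (E n)}
    (hM : IsSubmanifold m Ω M) {a : E n} (ha : a ∈ M) :
    ∃ (U : Set (E n)) (ρ : Fin (n - m) → E n → ℝ), a ∈ U ∧
      IsOrthonormalDefiningSystem m M U ρ := by
  obtain ⟨U, ρ, hU, haU, hρ, hMU, hlin⟩ := hM.exists_linearIndependent_gradient ha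
  let v : E n → Fin (n - m) → E n := fun x j => ∇ (ρ j) x
  let w : E n → Fin (n - m) → E n := fun x => gramSchmidtNormed ℝ (v x)
  have hv (j : Fin (n - m)) : ContDiffOn ℝ ∞ (fun x => v x j) U := contDiffOn_gradient hU (hρ j)
  have hw (j : Fin (n - m)) : ContDiffOn ℝ ∞ (fun x => w x j) U :=
    contDiffOn_gramSchmidtNormed hv hlin j
  have hdual (j : Fin (n - m)) : ContDiffOn ℝ ∞ (fun x => gramDual (v x) j) U :=
    contDiffOn_gramDual hv hlin j
  have hspan (x : E n) : Submodule.span ℝ (Set.range (w x)) = Submodule.span ℝ (Set.range (v x)) :=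
    (span_gramSchmidtNormed_range (v x)).trans (span_gramSchmidt ℝ (v x))
  have hdiff {W : Type} [NormedAddCommGroup W] [NormedSpace ℝ W] {g : E n → W}
      (hg : ContDiffOn ℝ ∞ g U) {x : E n} (hx : x ∈ U) : DifferentiableAt ℝ g x :=
    (hg.contDiffAt (hU.mem_nhds hx)).differentiableAt (by simp)
  refine ⟨U, fun j x => inner ℝ (w x j) (gradientLift ρ x), haU, hU, fun j => ?_, ?_, ?_⟩
  · exact (hw j).inner ℝ (ContDiffOn.sum fun k _ => (hρ k).smul (hdual k))
  · rw [hMU]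
    ext x
    exact and_congr_right fun hx =>
      (sum_smul_gramDual_orthogonal_iff (hlin x hx) (hspan x) fun k => ρ k x).symm
  · intro x hx
    have h0 : ∀ k, ρ k x = 0 := (hMU.le hx).2
    have hgrad (j : Fin (n - m)) : ∇ (fun x => inner ℝ (w x j) (gradientLift ρ x)) x = w x j :=
      gradient_inner_gradientLift (hlin x hx.2) (fun k => hdiff (hρ k) hx.2)
        (fun k => hdiff (hdual k) hx.2) h0 (hdiff (hw j) hx.2)
        ((hspan x).le (Submodule.subset_span ⟨j, rfl⟩))
    simp only [hgrad]
    exact gramSchmidtNormed_orthonormal (hlin x hx.2)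

end

/-! ### Tangential divergence -/

section

open Module Matrix MeasureTheory Filter Topology

variable {m n : ℕ}

/-- The bilinear form `(u, v) ↦ ⟪DX(x) u, v⟫` of a vector field `X`. -/
def derivForm (X : E n → E n) (x : E n) : E n →L[ℝ] E n →L[ℝ] ℝ :=
  innerSL ℝ ∘L fderiv ℝ X x

/-- The divergence along `M` of a vector field `X` that need not be tangent to `M`. -/
def tangentialDiv (M : Set (E n)) (X : E n → E n) (x : E n) : ℝ :=
  tangentialTrace M x (derivForm X x)

theorem tangentialDiv_eq_zero {M : Set (E n)} {X : E n → E n} {x : E n} (hx : x ∉ tsupport X) :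
    tangentialDiv M X x = 0 := by
  have hfderiv : fderiv ℝ X x = 0 := by
    rw [(notMem_tsupport_iff_eventuallyEq.1 hx).fderiv_eq]
    exact fderiv_const_apply _
  simp [tangentialDiv, tangentialTrace, derivForm, hfderiv]

theorem integrableOn_of_eq_zero_off_isCompact {X W : Type*} [TopologicalSpace X] [T2Space X]
    [MeasurableSpace X] [OpensMeasurableSpace X] [NormedAddCommGroup W]
    [SecondCountableTopologyEither X W] {μ : Measure X} [IsFiniteMeasureOnCompacts μ] {V K : Set X}
    (hV : MeasurableSet V) (hK : IsCompact K) (hKV : K ⊆ V) {g : X → W} (hg : ContinuousOn g V)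
    (hg0 : ∀ y ∈ V, y ∉ K → g y = 0) : IntegrableOn g V μ :=
  IntegrableOn.of_forall_sdiff_eq_zero
    ((hg.mono hKV).integrableOn_compact' hK hK.measurableSet) hV fun y hy => hg0 y hy.1 hy.2

namespace IsParam

variable {V : Set (E m)} {f : E m → E n} {π : E n →L[ℝ] E m}

theorem integrableOn_inner_laplacian (hf : IsParam V f π) {K : Set (E m)} (hK : IsCompact K)
    (hKV : K ⊆ V) {Φ : E m → E n} (hΦ : ContinuousOn Φ V) (hΦ0 : ∀ y ∈ V, y ∉ K → Φ y = 0) :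
    IntegrableOn (fun y => inner ℝ (laplacian f y) (Φ y)) V :=
  integrableOn_of_eq_zero_off_isCompact hf.isOpen.measurableSet hK hKV
    (hf.continuousOn_laplacian.inner hΦ)
    fun y hy hyK => by rw [hΦ0 y hy hyK, inner_zero_right]

theorem integral_sum_inner_coframe_pd (hf : IsParam V f π) {K : Set (E m)} (hK : IsCompact K)
    (hKV : K ⊆ V) {Φ : E m → E n} (hΦ : ContDiffOn ℝ 1 Φ V) (hΦ0 : ∀ y ∈ V, y ∉ K → Φ y = 0) :
    ∫ y in V, ∑ j, inner ℝ (coframe f j y) (pd Φ j y) =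
      -∫ y in V, inner ℝ (laplacian f y) (Φ y) := by
  have hpd0 (y : E m) (hy : y ∈ V) (hyK : y ∉ K) (j : Fin m) : pd Φ j y = 0 := by
    have h0 : Φ =ᶠ[𝓝 y] fun _ => 0 :=
      eventually_of_mem ((hf.isOpen.sdiff hK.isClosed).mem_nhds ⟨hy, hyK⟩)
        fun z hz => hΦ0 z hz.1 hz.2
    rw [pd_congr h0, pd, fderiv_const_apply, _root_.zero_apply]
  have hint : IntegrableOn (fun y => ∑ j, inner ℝ (coframe f j y) (pd Φ j y)) V :=
    integrableOn_of_eq_zero_off_isCompact hf.isOpen.measurableSet hK hKV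
      (continuousOn_finsetSum _ fun j _ => (hf.contDiffOn_coframe j).continuousOn.inner
        ((hΦ.continuousOn_fderiv_of_isOpen hf.isOpen (by norm_num)).clm_apply continuousOn_const))
      fun y hy hyK => Finset.sum_eq_zero fun j _ => by rw [hpd0 y hy hyK, inner_zero_right]
  have h := hf.integral_coframe_add_laplacian hK hKV hΦ hΦ0
  rw [integral_add hint (hf.integrableOn_inner_laplacian hK hKV hΦ.continuousOn hΦ0)] at h
  exact eq_neg_of_add_eq_zero_left h

end IsParam

namespace IsChart

variable {M U : Set (E n)} {V : Set (E m)} {f : E m → E n} {π : E n →L[ℝ] E m}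
  {W : Type*} [NormedAddCommGroup W]

theorem continuousOn (hf : IsChart M U V f π) : ContinuousOn f V := hf.contDiffOn.continuousOn

theorem measurableSet (hf : IsChart M U V f π) : MeasurableSet (M ∩ U) := by
  rw [← hf.image_eq]
  exact hf.isOpen.measurableSet.image_of_continuousOn_injOn hf.continuousOn
    fun y hy z hz hyz => by rw [← hf.left_inv y hy, ← hf.left_inv z hz, hyz]

theorem map_restrict (hf : IsChart M U V f π) :
    (μHE[m].restrict (M ∩ U)).map π =
      (volume.restrict V).withDensity fun y => ENNReal.ofReal (jac f y) := by
  rw [← hf.image_eq, hf.map_restrict_image, restrict_withDensity hf.isOpen.measurableSet]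

theorem aemeasurable_jac (hf : IsChart M U V f π) :
    AEMeasurable (fun y => ENNReal.ofReal (jac f y)) (volume.restrict V) :=
  (hf.contDiffOn_jac.continuousOn.aemeasurable hf.isOpen.measurableSet).ennreal_ofReal

theorem aestronglyMeasurable_map (hf : IsChart M U V f π) {g : E m → W} (hg : ContinuousOn g V) :
    AEStronglyMeasurable g ((μHE[m].restrict (M ∩ U)).map π) := by
  rw [hf.map_restrict, ← restrict_withDensity hf.isOpen.measurableSet]
  exact hg.aestronglyMeasurable hf.isOpen.measurableSet

variable [NormedSpace ℝ W]

theorem setIntegral_eq (hf : IsChart M U V f π) {h : E n → W}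
    (hh : ContinuousOn (fun y => h (f y)) V) :
    ∫ x in M ∩ U, h x ∂μHE[m] = ∫ y in V, jac f y • h (f y) := by
  calc ∫ x in M ∩ U, h x ∂μHE[m]
      = ∫ x in M ∩ U, h (f (π x)) ∂μHE[m] :=
        setIntegral_congr_fun hf.measurableSet fun x hx => by rw [hf.right_inv hx]
    _ = ∫ y, h (f y) ∂(μHE[m].restrict (M ∩ U)).map π :=
        (integral_map π.continuous.measurable.aemeasurable (hf.aestronglyMeasurable_map hh)).symm
    _ = ∫ y in V, (ENNReal.ofReal (jac f y)).toReal • h (f y) := by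
        rw [hf.map_restrict, integral_withDensity_eq_integral_toReal_smul₀ hf.aemeasurable_jac
          (Eventually.of_forall fun _ => ENNReal.ofReal_lt_top)]
    _ = ∫ y in V, jac f y • h (f y) :=
        setIntegral_congr_fun hf.isOpen.measurableSet fun y hy => by
          rw [ENNReal.toReal_ofReal (hf.jac_pos hy).le]

theorem integrableOn (hf : IsChart M U V f π) {h : E n → W}
    (hint : IntegrableOn (fun y => jac f y • h (f y)) V) : IntegrableOn h (M ∩ U) μHE[m] := by
  have hmap : Integrable (fun y => h (f y)) ((μHE[m].restrict (M ∩ U)).map π) := by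
    rw [hf.map_restrict, integrable_withDensity_iff_integrable_smul₀' hf.aemeasurable_jac
      (Eventually.of_forall fun _ => ENNReal.ofReal_lt_top)]
    exact hint.congr_fun (fun y hy => by rw [ENNReal.toReal_ofReal (hf.jac_pos hy).le])
      hf.isOpen.measurableSet
  have hcomp : IntegrableOn (fun x => h (f (π x))) (M ∩ U) μHE[m] :=
    hmap.comp_measurable π.continuous.measurable
  exact hcomp.congr_fun (fun x hx => congrArg h (hf.right_inv hx)) hf.measurableSet

theorem restrict (hf : IsChart M U V f π) {V' : Set (E m)} (hV' : IsOpen V') :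
    IsChart M (U ∩ π ⁻¹' V') (V ∩ V') f π where
  isOpen := hf.isOpen.inter hV'
  contDiffOn := hf.contDiffOn.mono Set.inter_subset_left
  left_inv y hy := hf.left_inv y hy.1
  isOpen_domain := hf.isOpen_domain.inter (hV'.preimage π.continuous)
  image_eq := by
    ext x
    constructor
    · rintro ⟨y, ⟨hy, hy'⟩, rfl⟩
      refine ⟨(hf.map_mem hy).1, (hf.map_mem hy).2, ?_⟩
      rwa [Set.mem_preimage, hf.left_inv y hy]
    · rintro ⟨hxM, hxU, hx⟩
      exact ⟨π x, ⟨hf.π_mem ⟨hxM, hxU⟩, hx⟩, hf.right_inv ⟨hxM, hxU⟩⟩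

theorem continuousOn_gramDual (hf : IsChart M U V f π) (i : Fin m) :
    ContinuousOn (fun y => gramDual (tangentFrame f y) i) V :=
  (contDiffOn_gramDual hf.contDiffOn_pd
    (fun _ hy => hf.linearIndependent_tangentFrame hy) i).continuousOn

theorem continuousOn_normalForm (hf : IsChart M U V f π) :
    ContinuousOn (fun y => normalForm (normalSpace M (f y))) V := by
  have hmul : ContinuousMul (Form n) :=
    ⟨(LinearMap.mul ℝ (Form n)).toContinuousBilinearMap.continuous₂⟩
  have hterm (i : Fin m) :
      ContinuousOn (fun y => kahler (pd f i y) (gramDual (tangentFrame f y) i)) V :=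
    ((kahler (n := n)).toContinuousBilinearMap.continuous.comp_continuousOn
      (hf.contDiffOn_pd i).continuousOn).clm_apply (hf.continuousOn_gramDual i)
  have hdiff : ContinuousOn
      (fun y => beta n - ∑ i, kahler (pd f i y) (gramDual (tangentFrame f y) i)) V :=
    continuousOn_const.sub (continuousOn_finsetSum _ fun i _ => hterm i)
  refine ((hdiff.fun_pow (n - m)).fun_const_smul ((n - m).factorial : ℝ)⁻¹).congr fun y hy => ?_
  rw [normalSpace, normalForm_orthogonal, hf.sum_tangentSpace hy kahler,
    hf.finrank_tangentSpace hy]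

theorem tangentialTrace_eq (hf : IsChart M U V f π) {y : E m} (hy : y ∈ V)
    (B : E n →L[ℝ] E n →L[ℝ] ℝ) :
    tangentialTrace M (f y) B = ∑ i, B (pd f i y) (gramDual (tangentFrame f y) i) :=
  hf.sum_tangentSpace hy (ContinuousLinearMap.coeLM ℝ ∘ₗ (B : E n →ₗ[ℝ] E n →L[ℝ] ℝ))

theorem jac_mul_tangentialDiv (hf : IsChart M U V f π) {X : E n → E n} {y : E m} (hy : y ∈ V)
    (hX : DifferentiableAt ℝ X (f y)) :
    jac f y * tangentialDiv M X (f y) =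
      ∑ i, inner ℝ (coframe f i y) (pd (fun y => X (f y)) i y) := by
  have hpd (i : Fin m) : pd (fun y => X (f y)) i y = fderiv ℝ X (f y) (pd f i y) :=
    DFunLike.congr_fun
      (hX.hasFDerivAt.comp y (hf.hasStrictFDerivAt hy).hasFDerivAt).fderiv _
  rw [tangentialDiv, hf.tangentialTrace_eq hy, Finset.mul_sum]
  refine Finset.sum_congr rfl fun i _ => ?_
  rw [hpd, coframe, real_inner_smul_left, real_inner_comm]
  rfl

theorem continuousOn_tangentialDiv (hf : IsChart M U V f π) {X : E n → E n}
    (hX : ContDiff ℝ 1 X) : ContinuousOn (fun y => tangentialDiv M X (f y)) V := by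
  have hDX : ContinuousOn (fun y => fderiv ℝ X (f y)) V :=
    (hX.continuous_fderiv (by norm_num)).comp_continuousOn hf.continuousOn
  have hsum : ContinuousOn (fun y => ∑ i, inner ℝ (fderiv ℝ X (f y) (pd f i y))
      (gramDual (tangentFrame f y) i)) V :=
    continuousOn_finsetSum _ fun i _ =>
      (hDX.clm_apply (hf.contDiffOn_pd i).continuousOn).inner (hf.continuousOn_gramDual i)
  exact hsum.congr fun y hy => hf.tangentialTrace_eq hy (derivForm X (f y))

end IsChart

end

/-! ### The supercurrent of a submanifold -/

section

open Module Matrix MeasureTheory Filter Topology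
open TopologicalSpace (Opens)

variable {m n : ℕ} {Ω : Opens (E n)} {M : Set (E n)}

namespace IsSubmanifold

theorem measurableSet (hM : IsSubmanifold m Ω M) : MeasurableSet M := by
  have h : M = closure M ∩ Ω :=
    hM.closed.antisymm' fun x hx => ⟨subset_closure hx, hM.subset hx⟩
  rw [h]
  exact isClosed_closure.measurableSet.inter Ω.isOpen.measurableSet

theorem finrank_tangentSpace (hM : IsSubmanifold m Ω M) (hmn : m ≤ n) {x : E n} (hx : x ∈ M) :
    finrank ℝ (tangentSpace M x) = m := by
  obtain ⟨U, V, f, π, hxU, -, hf⟩ := hM.exists_isChart hmn hx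
  rw [← hf.right_inv ⟨hx, hxU⟩]
  exact hf.finrank_tangentSpace (hf.π_mem ⟨hx, hxU⟩)

theorem notMem_closure (hM : IsSubmanifold m Ω M) {x : E n} (hx : x ∈ Ω) (hxM : x ∉ M) :
    x ∉ closure M :=
  fun h => hxM (hM.closed ⟨h, hx⟩)

theorem exists_nhds_integrableOn_normalForm (hM : IsSubmanifold m Ω M) (hmn : m ≤ n) {x : E n}
    (hx : x ∈ M) :
    ∃ O, IsOpen O ∧ x ∈ O ∧
      IntegrableOn (fun x => normalForm (normalSpace M x)) (M ∩ O) μHE[m] := by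
  obtain ⟨U, V, f, π, hxU, -, hf⟩ := hM.exists_isChart hmn hx
  obtain ⟨r, hr, hrV⟩ := Metric.nhds_basis_closedBall.mem_iff.1
    (hf.isOpen.mem_nhds (hf.π_mem ⟨hx, hxU⟩))
  have hf' := hf.restrict (V' := Metric.ball (π x) r) Metric.isOpen_ball
  have hcont : ContinuousOn (fun y => jac f y • normalForm (normalSpace M (f y))) V :=
    hf.contDiffOn_jac.continuousOn.smul hf.continuousOn_normalForm
  have hint : IntegrableOn (fun y => jac f y • normalForm (normalSpace M (f y)))
      (V ∩ Metric.ball (π x) r) :=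
    ((hcont.mono hrV).integrableOn_compact (isCompact_closedBall _ _)).mono_set
      (Set.inter_subset_right.trans Metric.ball_subset_closedBall)
  exact ⟨_, hf'.isOpen_domain, ⟨hxU, Metric.mem_ball_self hr⟩, hf'.integrableOn hint⟩

theorem locallyIntegrableOn_normalForm (hM : IsSubmanifold m Ω M) (hmn : m ≤ n) :
    LocallyIntegrableOn (fun x => normalForm (normalSpace M x)) Ω (μHE[m].restrict M) := by
  intro x hx
  suffices h : ∃ O, IsOpen O ∧ x ∈ O ∧
      IntegrableOn (fun x => normalForm (normalSpace M x)) (M ∩ O) μHE[m] by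
    obtain ⟨O, hO, hxO, hint⟩ := h
    refine ⟨O, mem_nhdsWithin_of_mem_nhds (hO.mem_nhds hxO), ?_⟩
    rwa [IntegrableOn, Measure.restrict_restrict hO.measurableSet, Set.inter_comm]
  by_cases hxM : x ∈ M
  · exact hM.exists_nhds_integrableOn_normalForm hmn hxM
  · refine ⟨(closure M)ᶜ, isClosed_closure.isOpen_compl, hM.notMem_closure hx hxM, ?_⟩
    rw [(Set.disjoint_compl_right_iff_subset.2 subset_closure).inter_eq]
    exact integrableOn_empty

end IsSubmanifold

theorem dTest_apply (ψ : 𝓓(Ω, Form n)) (x : E n) :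
    dTest Ω ψ x = ∑ k, dx k * fderiv ℝ ψ x (EuclideanSpace.single k 1) := by
  have hψ : DifferentiableAt ℝ ψ x := ψ.contDiff.differentiable (by simp) x
  rw [dTest, _root_.sum_apply, _root_.sum_apply]
  refine Finset.sum_congr rfl fun k _ => ?_
  change dx k * TestFunction.lineDerivCLM ℝ (EuclideanSpace.single k (1 : ℝ)) ψ x = _
  rw [TestFunction.lineDerivCLM_apply_of_le (by simp), hψ.lineDeriv_eq_fderiv]

theorem fderiv_xiVector {φ : E n → Form n} {x : E n} (hφ : DifferentiableAt ℝ φ x) (v : E n) :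
    fderiv ℝ (fun x => xiVector (φ x)) x v = xiVector (fderiv ℝ φ x v) :=
  DFunLike.congr_fun
    ((xiVector (n := n)).toContinuousLinearMap.hasFDerivAt.comp x hφ.hasFDerivAt).fderiv v

theorem topCoeff_normalForm_mul_dTest {x : E n} (ψ : 𝓓(Ω, Form n)) :
    topCoeff n (normalForm (normalSpace M x) *
        (beta n ^ (finrank ℝ (tangentSpace M x) - 1) * dTest Ω ψ x)) =
      ((finrank ℝ (tangentSpace M x) - 1).factorial : ℝ) *
        tangentialDiv M (fun x => xiVector (ψ x)) x := by
  have hψ : DifferentiableAt ℝ ψ x := ψ.contDiff.differentiable (by simp) x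
  rw [dTest_apply, Finset.mul_sum, Finset.mul_sum, map_sum]
  simp_rw [dx_eq_lower, normalSpace, topCoeff_normalForm_mul]
  rw [← Finset.mul_sum, Finset.sum_comm, tangentialDiv, tangentialTrace]
  congr 1
  refine Finset.sum_congr rfl fun i _ => ?_
  set e : E n := (stdOrthonormalBasis ℝ (tangentSpace M x) i : E n)
  have he : ∑ k, e k • EuclideanSpace.single k (1 : ℝ) = e := by
    simpa using (EuclideanSpace.basisFun (Fin n) ℝ).sum_repr e
  calc ∑ k, inner ℝ e (EuclideanSpace.single k 1) *
        inner ℝ e (xiVector (fderiv ℝ ψ x (EuclideanSpace.single k 1)))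
      = inner ℝ e (xiVector (fderiv ℝ ψ x (∑ k, e k • EuclideanSpace.single k 1))) := by
        simp [inner_sum, real_inner_smul_right, EuclideanSpace.inner_single_right]
    _ = derivForm (fun x => xiVector (ψ x)) x e e := by
        rw [he, ← fderiv_xiVector hψ, real_inner_comm]
        rfl

theorem tangentialDiv_neg (X : E n → E n) (x : E n) :
    tangentialDiv M (fun x => -X x) x = -tangentialDiv M X x := by
  simp [tangentialDiv, tangentialTrace, derivForm, fderiv_fun_neg]

/-- The `(0, 1)`-form `∑ vᵢ dξᵢ` of a vector `v`. -/
def dxiForm : E n →ₗ[ℝ] Form n := (J n).toLinearMap ∘ₗ ExteriorAlgebra.ι ℝ ∘ₗ covector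

theorem xiVector_dxiForm (v : E n) : xiVector (dxiForm v) = v := by
  have h : dxiForm v = J n (lower v) := congrArg (J n) (lower_eq_ι v).symm
  rw [h, xiVector_J_lower]

/-- `M` is stationary for the `m`-dimensional area: its first variation vanishes along every vector
field with compact support in `Ω`. -/
def IsStationary (m : ℕ) (Ω : Opens (E n)) (M : Set (E n)) : Prop :=
  ∀ X : 𝓓(Ω, E n), ∫ x in M, tangentialDiv M X x ∂μHE[m] = 0

namespace IsSubmanifold

theorem d_wedge_apply (hM : IsSubmanifold m Ω M) (hmn : m ≤ n) (φ : 𝓓(Ω, Form n)) :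
    ((superCurrent m Ω M).wedge (beta n ^ (m - 1))).d φ =
      -(((m - 1).factorial : ℝ) *
        ∫ x in M, tangentialDiv M (fun x => xiVector (φ x)) x ∂μHE[m]) := by
  set ψ : 𝓓(Ω, Form n) := TestFunction.postcompCLM
    (degreeSign n).toLinearMap.toContinuousLinearMap φ
  have hψφ : (fun x => xiVector (ψ x)) = fun x => -xiVector (φ x) :=
    funext fun x => xiVector_degreeSign (φ x)
  have hd : ((superCurrent m Ω M).wedge (beta n ^ (m - 1))).d φ =
      ∫ x in M, topCoeff n (normalForm (normalSpace M x) * (beta n ^ (m - 1) * dTest Ω ψ x))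
        ∂μHE[m] :=
    TestFunction.integralAgainstBilinCLM_eq_integral
      (hM.locallyIntegrableOn_normalForm hmn)
      (f := TestFunction.postcompCLM (wedgeLeft (beta n ^ (m - 1))) (dTest Ω ψ))
  rw [hd, ← integral_const_mul, ← integral_neg]
  refine setIntegral_congr_fun hM.measurableSet fun x hx => ?_
  have htop := topCoeff_normalForm_mul_dTest (M := M) (x := x) ψ
  rwa [hM.finrank_tangentSpace hmn hx, hψφ, tangentialDiv_neg, mul_neg] at htop

theorem integral_tangentialDiv_eq (hM : IsSubmanifold m Ω M) (hmn : m ≤ n) (X : 𝓓(Ω, E n)) :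
    ∫ x in M, tangentialDiv M X x ∂μHE[m] =
      -((m - 1).factorial : ℝ)⁻¹ * ((superCurrent m Ω M).wedge (beta n ^ (m - 1))).d
        (TestFunction.postcompCLM dxiForm.toContinuousLinearMap X) := by
  set φ := TestFunction.postcompCLM (Ω := Ω) (n := ⊤) (dxiForm (n := n)).toContinuousLinearMap X
  have hφ : (fun x => xiVector (φ x)) = X := funext fun x => xiVector_dxiForm (X x)
  have hfact : ((m - 1).factorial : ℝ) ≠ 0 := Nat.cast_ne_zero.2 (Nat.factorial_ne_zero _)
  rw [hM.d_wedge_apply hmn, hφ]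
  field_simp

theorem isClosed_iff_isStationary (hM : IsSubmanifold m Ω M) (hmn : m ≤ n) :
    ((superCurrent m Ω M).wedge (beta n ^ (m - 1))).IsClosed ↔ IsStationary m Ω M := by
  constructor
  · intro h X
    rw [hM.integral_tangentialDiv_eq hmn, show Supercurrent.d _ = 0 from h, _root_.zero_apply,
      mul_zero]
  · intro h
    ext φ
    rw [hM.d_wedge_apply hmn, _root_.zero_apply, neg_eq_zero]
    exact mul_eq_zero_of_right _ (h (TestFunction.postcompCLM xiVector.toContinuousLinearMap φ))

-- Linearity is inherited from the supercurrent, which avoids the integrability of `tangentialDiv`.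
theorem isLinearMap_integral_tangentialDiv (hM : IsSubmanifold m Ω M) (hmn : m ≤ n) :
    IsLinearMap ℝ fun X : 𝓓(Ω, E n) => ∫ x in M, tangentialDiv M X x ∂μHE[m] := by
  simp_rw [hM.integral_tangentialDiv_eq hmn]
  exact (-((m - 1).factorial : ℝ)⁻¹ • (((superCurrent m Ω M).wedge (beta n ^ (m - 1))).d ∘L
    TestFunction.postcompCLM dxiForm.toContinuousLinearMap)).toLinearMap.isLinear

end IsSubmanifold

namespace IsChart

variable {U : Set (E n)} {V : Set (E m)} {f : E m → E n} {π : E n →L[ℝ] E m} {X : E n → E n}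

theorem isCompact_image_tsupport (hf : IsChart M U V f π) (hM : IsSubmanifold m Ω M) (hU : U ⊆ Ω)
    (hXc : HasCompactSupport X) (hXU : tsupport X ⊆ U) :
    IsCompact (π '' (M ∩ tsupport X)) ∧ π '' (M ∩ tsupport X) ⊆ V ∧
      ∀ y ∈ V, y ∉ π '' (M ∩ tsupport X) → X (f y) = 0 := by
  have hclosure : M ∩ tsupport X = closure M ∩ tsupport X :=
    (Set.inter_subset_inter_left _ subset_closure).antisymm
      fun x hx => ⟨hM.closed ⟨hx.1, hU (hXU hx.2)⟩, hx.2⟩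
  refine ⟨?_, ?_, fun y hy hyK => ?_⟩
  · rw [hclosure]
    exact (hXc.isCompact.inter_left isClosed_closure).image π.continuous
  · rintro _ ⟨x, hx, rfl⟩
    exact hf.π_mem ⟨hx.1, hXU hx.2⟩
  · by_contra h
    exact hyK ⟨f y, ⟨(hf.map_mem hy).1, subset_tsupport _ h⟩, hf.left_inv y hy⟩

theorem integral_tangentialDiv (hf : IsChart M U V f π) (hM : IsSubmanifold m Ω M) (hU : U ⊆ Ω)
    (hX : ContDiff ℝ 1 X) (hXc : HasCompactSupport X) (hXU : tsupport X ⊆ U) :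
    ∫ x in M, tangentialDiv M X x ∂μHE[m] = -∫ y in V, inner ℝ (laplacian f y) (X (f y)) := by
  obtain ⟨hK, hKV, hX0⟩ := hf.isCompact_image_tsupport hM hU hXc hXU
  calc ∫ x in M, tangentialDiv M X x ∂μHE[m]
      = ∫ x in M ∩ U, tangentialDiv M X x ∂μHE[m] :=
        setIntegral_eq_of_subset_of_forall_sdiff_eq_zero hM.measurableSet Set.inter_subset_left
          fun x hx => tangentialDiv_eq_zero fun h => hx.2 ⟨hx.1, hXU h⟩
    _ = ∫ y in V, jac f y * tangentialDiv M X (f y) :=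
        hf.setIntegral_eq (hf.continuousOn_tangentialDiv hX)
    _ = ∫ y in V, ∑ j, inner ℝ (coframe f j y) (pd (fun y => X (f y)) j y) :=
        setIntegral_congr_fun hf.isOpen.measurableSet fun y hy =>
          hf.jac_mul_tangentialDiv hy (hX.differentiable one_ne_zero (f y))
    _ = -∫ y in V, inner ℝ (laplacian f y) (X (f y)) :=
        hf.integral_sum_inner_coframe_pd hK hKV
          (hX.comp_contDiffOn (hf.contDiffOn.of_le (by norm_num))) hX0

end IsChart

end

/-! ### Stationarity and minimality -/

section

open Module MeasureTheory Filter Topology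
open TopologicalSpace (Opens)
open scoped Manifold

variable {m n : ℕ} {Ω : Opens (E n)} {M : Set (E n)}

theorem eq_zero_of_inner_eq_zero {ι κ F : Type*} [Fintype ι] [Fintype κ] [NormedAddCommGroup F]
    [InnerProductSpace ℝ F] [FiniteDimensional ℝ F] {A : ι → F} {B : κ → F}
    (hA : LinearIndependent ℝ A) (hB : LinearIndependent ℝ B)
    (hcard : Fintype.card ι + Fintype.card κ = finrank ℝ F) (hAB : ∀ i j, inner ℝ (A i) (B j) = 0)
    {v : F} (hvA : ∀ i, inner ℝ (A i) v = 0) (hvB : ∀ j, inner ℝ (B j) v = 0) : v = 0 := by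
  have hortho : Submodule.span ℝ (Set.range A) ⟂ Submodule.span ℝ (Set.range B) :=
    Submodule.isOrtho_span.2 <| Set.forall_mem_range.2 fun i => Set.forall_mem_range.2 (hAB i)
  have htop : Submodule.span ℝ (Set.range (Sum.elim A B)) = ⊤ :=
    (hA.sum_type hB hortho.disjoint).span_eq_top_of_card_eq_finrank'
      (by rw [Fintype.card_sum, hcard])
  have hv : (⊤ : Submodule ℝ F) ⟂ Submodule.span ℝ {v} := by
    rw [← htop, Submodule.isOrtho_span]
    rintro _ ⟨i | j, rfl⟩ _ rfl
    exacts [hvA i, hvB j]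
  rwa [Submodule.isOrtho_top_left, Submodule.span_singleton_eq_bot] at hv

theorem exists_contDiff_eq_one_of_isCompact {F : Type*} [NormedAddCommGroup F] [NormedSpace ℝ F]
    [FiniteDimensional ℝ F] {K U : Set F} (hK : IsCompact K) (hU : IsOpen U) (hKU : K ⊆ U) :
    ∃ χ : F → ℝ, ContDiff ℝ ∞ χ ∧ HasCompactSupport χ ∧ tsupport χ ⊆ U ∧ ∀ x ∈ K, χ x = 1 := by
  obtain ⟨L, hL, hKL, hLU⟩ := exists_compact_between hK hU hKU
  obtain ⟨χ, hχ1, hχ0, -⟩ :=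
    exists_contMDiffMap_one_nhds_of_subset_interior 𝓘(ℝ, F) (n := ⊤) hK.isClosed hKL
  have hsupp : tsupport χ ⊆ L :=
    closure_minimal (fun x hx => not_imp_comm.1 (hχ0 x) hx) hL.isClosed
  exact ⟨χ, χ.contMDiff.contDiff, hL.of_isClosed_subset (isClosed_tsupport _) hsupp,
    hsupp.trans hLU, fun x hx => hχ1.self_of_nhdsSet x hx⟩

namespace IsChart

variable {U U' : Set (E n)} {V : Set (E m)} {f : E m → E n} {π : E n →L[ℝ] E m}
  {ρ : Fin (n - m) → E n → ℝ} {y : E m}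

theorem exists_contDiff_comp_eq (hf : IsChart M U V f π) {g : E m → ℝ} (hg : ContDiff ℝ ∞ g)
    (hgc : HasCompactSupport g) (hgV : tsupport g ⊆ V) :
    ∃ η : E n → ℝ, ContDiff ℝ ∞ η ∧ HasCompactSupport η ∧ tsupport η ⊆ U ∧
      ∀ y, y ∈ V → η (f y) = g y := by
  obtain ⟨χ, hχ, hχc, hχU, hχ1⟩ := exists_contDiff_eq_one_of_isCompact
    (hgc.isCompact.image_of_continuousOn (hf.continuousOn.mono hgV)) hf.isOpen_domain
    (Set.image_subset_iff.2 fun y hy => (hf.map_mem (hgV hy)).2)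
  refine ⟨fun x => χ x * g (π x), hχ.mul (hg.comp π.contDiff), hχc.mul_right,
    (tsupport_mul_subset_left).trans hχU, fun y hy => ?_⟩
  simp only [hf.left_inv y hy]
  by_cases hyg : y ∈ tsupport g
  · rw [hχ1 _ (Set.mem_image_of_mem f hyg), one_mul]
  · rw [image_eq_zero_of_notMem_tsupport hyg, mul_zero]

theorem eventually_eq_zero (hf : IsChart M U V f π) (hρ : IsOrthonormalDefiningSystem m M U' ρ)
    (hy : y ∈ V) (hyU : f y ∈ U') (j : Fin (n - m)) : ∀ᶠ z in 𝓝 y, ρ j (f z) = 0 := by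
  filter_upwards [hf.isOpen.mem_nhds hy,
    (hf.contDiffAt hy).continuousAt.preimage_mem_nhds (hρ.isOpen.mem_nhds hyU)] with z hz hzU
  have h : f z ∈ M ∩ U' := ⟨(hf.map_mem hz).1, hzU⟩
  rw [hρ.inter_eq] at h
  exact h.2 j

theorem inner_gradient_pd (hf : IsChart M U V f π) (hρ : IsOrthonormalDefiningSystem m M U' ρ)
    (hy : y ∈ V) (hyU : f y ∈ U') (j : Fin (n - m)) (k : Fin m) :
    inner ℝ (∇ (ρ j) (f y)) (pd f k y) = 0 := by
  have hρj : DifferentiableAt ℝ (ρ j) (f y) :=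
    ((hρ.contDiffOn j).contDiffAt (hρ.isOpen.mem_nhds hyU)).differentiableAt (by simp)
  have hcomp := hρj.hasFDerivAt.comp y (hf.hasStrictFDerivAt hy).hasFDerivAt
  have hzero : HasFDerivAt (ρ j ∘ f) (0 : E m →L[ℝ] ℝ) y :=
    (hasFDerivAt_const (0 : ℝ) y).congr_of_eventuallyEq (hf.eventually_eq_zero hρ hy hyU j)
  rw [inner_gradient_left]
  exact DFunLike.congr_fun (hcomp.unique hzero) _

theorem inner_gradient_laplacian (hf : IsChart M U V f π)
    (hρ : IsOrthonormalDefiningSystem m M U' ρ) (hy : y ∈ V) (hyU : f y ∈ U') (j : Fin (n - m)) :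
    inner ℝ (∇ (ρ j) (f y)) (laplacian f y) =
      -(jac f y * tangentialTrace M (f y) (fderiv ℝ (fderiv ℝ (ρ j)) (f y))) := by
  have hlap := hf.fderiv_laplacian hy
    (((hρ.contDiffOn j).contDiffAt (hρ.isOpen.mem_nhds hyU)).of_le (WithTop.coe_le_coe.2 le_top))
    (hf.eventually_eq_zero hρ hy hyU j)
  simp only [coframe, map_smul, smul_eq_mul, ← Finset.mul_sum] at hlap
  rw [inner_gradient_left, hf.tangentialTrace_eq hy, hlap]

theorem laplacian_eq_zero_iff_inner_gradient (hf : IsChart M U V f π) (hmn : m ≤ n)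
    (hρ : IsOrthonormalDefiningSystem m M U' ρ) (hy : y ∈ V) (hyU : f y ∈ U') :
    laplacian f y = 0 ↔ ∀ j, inner ℝ (∇ (ρ j) (f y)) (laplacian f y) = 0 := by
  refine ⟨fun h j => by rw [h, inner_zero_right], fun h => ?_⟩
  have hgrad := (hρ.orthonormal (f y) ⟨(hf.map_mem hy).1, hyU⟩).linearIndependent
  exact eq_zero_of_inner_eq_zero hgrad (hf.linearIndependent_tangentFrame hy) (by simp [hmn])
    (hf.inner_gradient_pd hρ hy hyU) h (fun k => (real_inner_comm _ _).trans
      (hf.inner_laplacian_pd hy k))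

theorem laplacian_eq_zero_iff (hf : IsChart M U V f π) (hmn : m ≤ n)
    (hρ : IsOrthonormalDefiningSystem m M U' ρ) (hy : y ∈ V) (hyU : f y ∈ U') :
    laplacian f y = 0 ↔
      ∑ j, tangentialTrace M (f y) (fderiv ℝ (fderiv ℝ (ρ j)) (f y)) • ∇ (ρ j) (f y) = 0 := by
  have hgrad := (hρ.orthonormal (f y) ⟨(hf.map_mem hy).1, hyU⟩).linearIndependent
  calc laplacian f y = 0
      ↔ ∀ j, inner ℝ (∇ (ρ j) (f y)) (laplacian f y) = 0 :=
        hf.laplacian_eq_zero_iff_inner_gradient hmn hρ hy hyU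
    _ ↔ ∀ j, tangentialTrace M (f y) (fderiv ℝ (fderiv ℝ (ρ j)) (f y)) = 0 :=
        forall_congr' fun j => by
          rw [hf.inner_gradient_laplacian hρ hy hyU, neg_eq_zero,
            mul_eq_zero_iff_left (hf.jac_pos hy).ne']
    _ ↔ ∑ j, tangentialTrace M (f y) (fderiv ℝ (fderiv ℝ (ρ j)) (f y)) • ∇ (ρ j) (f y) = 0 :=
        ⟨fun h => Finset.sum_eq_zero fun j _ => by rw [h j, zero_smul],
          Fintype.linearIndependent_iff.1 hgrad _⟩

theorem laplacian_eq_zero_of_isMinimal (hf : IsChart M U V f π) (hmn : m ≤ n)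
    (hmin : IsMinimal m M) (hy : y ∈ V) : laplacian f y = 0 := by
  obtain ⟨U', ρ, hyU, hρ, h⟩ := hmin (f y) (hf.map_mem hy).1
  exact (hf.laplacian_eq_zero_iff hmn hρ hy hyU).2 h.symm

theorem integral_smul_inner_laplacian (hf : IsChart M U V f π) (hM : IsSubmanifold m Ω M)
    (hU : U ⊆ Ω) (hst : IsStationary m Ω M) {g : E m → ℝ} (hg : ContDiff ℝ ∞ g)
    (hgc : HasCompactSupport g) (hgV : tsupport g ⊆ V) (w : E n) :
    ∫ y, g y • inner ℝ (laplacian f y) w = 0 := by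
  obtain ⟨η, hη, hηc, hηU, hηg⟩ := hf.exists_contDiff_comp_eq hg hgc hgV
  let X : 𝓓(Ω, E n) := ⟨fun x => η x • w, hη.smul contDiff_const, hηc.smul_right,
    (tsupport_smul_subset_left η _).trans (hηU.trans hU)⟩
  have hXU : tsupport X ⊆ U := (tsupport_smul_subset_left η _).trans hηU
  calc ∫ y, g y • inner ℝ (laplacian f y) w
      = ∫ y in V, g y • inner ℝ (laplacian f y) w :=
        (setIntegral_eq_integral_of_forall_compl_eq_zero fun y hy => by
          rw [image_eq_zero_of_notMem_tsupport fun h => hy (hgV h), zero_smul]).symm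
    _ = ∫ y in V, inner ℝ (laplacian f y) (X (f y)) :=
        setIntegral_congr_fun hf.isOpen.measurableSet fun y hy => by
          rw [← hηg y hy, smul_eq_mul, ← real_inner_smul_right]
          rfl
    _ = -∫ x in M, tangentialDiv M X x ∂μHE[m] := by
        rw [hf.integral_tangentialDiv hM hU (X.contDiff.of_le (by simp)) X.hasCompactSupport hXU,
          neg_neg]
    _ = 0 := by rw [hst X, neg_zero]

theorem laplacian_eq_zero_of_isStationary (hf : IsChart M U V f π) (hM : IsSubmanifold m Ω M)
    (hU : U ⊆ Ω) (hst : IsStationary m Ω M) (hy : y ∈ V) : laplacian f y = 0 := by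
  have hcont : ContinuousOn (fun z => inner ℝ (laplacian f z) (laplacian f y)) V :=
    hf.continuousOn_laplacian.inner continuousOn_const
  have hae : ∀ᵐ z, z ∈ V → inner ℝ (laplacian f z) (laplacian f y) = 0 :=
    hf.isOpen.ae_eq_zero_of_integral_contDiff_smul_eq_zero
      (hcont.locallyIntegrableOn hf.isOpen.measurableSet)
      fun g hg hgc hgV => hf.integral_smul_inner_laplacian hM hU hst hg hgc hgV _
  have hzero := Measure.eqOn_open_of_ae_eq
    ((ae_restrict_iff' hf.isOpen.measurableSet).2 hae) hf.isOpen hcont continuousOn_const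
  exact inner_self_eq_zero.1 (hzero hy)

end IsChart

theorem eq_zero_of_locally_eq_zero {F : Type*} [NormedAddCommGroup F] [NormedSpace ℝ F]
    (Λ : 𝓓(Ω, F) →ₗ[ℝ] ℝ)
    (h : ∀ a ∈ Ω, ∃ O : Set (E n), IsOpen O ∧ a ∈ O ∧ ∀ φ : 𝓓(Ω, F), tsupport φ ⊆ O → Λ φ = 0) :
    Λ = 0 := by
  ext φ
  choose! O hO haO hΛ using h
  obtain ⟨p, hp⟩ := SmoothPartitionOfUnity.exists_isSubordinate 𝓘(ℝ, E n) (s := tsupport φ)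
    (isClosed_tsupport _) (fun a : Ω => O a) (fun a => hO a a.2)
    fun x hx => Set.mem_iUnion.2 ⟨⟨x, φ.tsupport_subset hx⟩, haO x (φ.tsupport_subset hx)⟩
  have hfin := p.locallyFinite.finite_nonempty_inter_compact φ.hasCompactSupport.isCompact
  have hsupp (i : Ω) : tsupport (fun x => p i x • φ x) ⊆ tsupport φ :=
    tsupport_smul_subset_right _ _
  let piece (i : Ω) : 𝓓(Ω, F) := ⟨fun x => p i x • φ x, (p i).contMDiff.contDiff.smul φ.contDiff,
    φ.hasCompactSupport.of_isClosed_subset (isClosed_tsupport _) (hsupp i),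
    (hsupp i).trans φ.tsupport_subset⟩
  have hφ : φ = ∑ i ∈ hfin.toFinset, piece i := by
    refine TestFunction.ext fun x => ?_
    rw [_root_.sum_apply]
    change φ x = ∑ i ∈ hfin.toFinset, p i x • φ x
    by_cases hx : x ∈ tsupport φ
    · rw [← Finset.sum_smul, ← finsum_eq_sum_of_support_subset, p.sum_eq_one hx, one_smul]
      intro i hi
      rw [Set.Finite.coe_toFinset]
      exact ⟨x, hi, hx⟩
    · simp [image_eq_zero_of_notMem_tsupport hx]
  rw [hφ, map_sum]
  exact Finset.sum_eq_zero fun i _ =>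
    hΛ i i.2 (piece i) ((tsupport_smul_subset_left _ _).trans (hp i))

namespace IsSubmanifold

theorem isStationary_of_isMinimal (hM : IsSubmanifold m Ω M) (hmn : m ≤ n)
    (hmin : IsMinimal m M) : IsStationary m Ω M := by
  suffices h : (hM.isLinearMap_integral_tangentialDiv hmn).mk' _ = 0 from
    fun X => LinearMap.congr_fun h X
  refine eq_zero_of_locally_eq_zero _ fun a ha => ?_
  by_cases haM : a ∈ M
  · obtain ⟨U, V, f, π, haU, hUΩ, hf⟩ := hM.exists_isChart hmn haM
    refine ⟨U, hf.isOpen_domain, haU, fun X hX => ?_⟩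
    rw [IsLinearMap.mk'_apply, hf.integral_tangentialDiv hM hUΩ (X.contDiff.of_le (by simp))
      X.hasCompactSupport hX, neg_eq_zero]
    exact setIntegral_eq_zero_of_forall_eq_zero fun y hy => by
      rw [hf.laplacian_eq_zero_of_isMinimal hmn hmin hy, inner_zero_left]
  · exact ⟨(closure M)ᶜ, isClosed_closure.isOpen_compl, hM.notMem_closure ha haM, fun X hX =>
      setIntegral_eq_zero_of_forall_eq_zero fun x hx =>
        tangentialDiv_eq_zero fun h => hX h (subset_closure hx)⟩

theorem isMinimal_of_isStationary (hM : IsSubmanifold m Ω M) (hmn : m ≤ n)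
    (hst : IsStationary m Ω M) : IsMinimal m M := by
  intro x hx
  obtain ⟨U, V, f, π, hxU, hUΩ, hf⟩ := hM.exists_isChart hmn hx
  obtain ⟨U', ρ, hxU', hρ⟩ := hM.exists_isOrthonormalDefiningSystem hx
  have hy : π x ∈ V := hf.π_mem ⟨hx, hxU⟩
  have hfx : f (π x) = x := hf.right_inv ⟨hx, hxU⟩
  have hsum := (hf.laplacian_eq_zero_iff hmn hρ hy (hfx.symm ▸ hxU')).1
    (hf.laplacian_eq_zero_of_isStationary hM hUΩ hst hy)
  rw [hfx] at hsum
  exact ⟨U', ρ, hxU', hρ, hsum.symm⟩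

theorem isStationary_iff_isMinimal (hM : IsSubmanifold m Ω M) (hmn : m ≤ n) :
    IsStationary m Ω M ↔ IsMinimal m M :=
  ⟨hM.isMinimal_of_isStationary hmn, hM.isStationary_of_isMinimal hmn⟩

end IsSubmanifold

end

end Super

end

theorem corollary5p2 (n m : ℕ) (hm : 1 ≤ m) (hmn : m ≤ n)
    (Ω : TopologicalSpace.Opens (Super.E n)) (M : Set (Super.E n))
    (hM : Super.IsSubmanifold m Ω M) :
    ((Super.superCurrent m Ω M).wedge (Super.beta n ^ (m - 1))).IsClosed ↔
      Super.IsMinimal m M :=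
  (hM.isClosed_iff_isStationary hmn).trans (hM.isStationary_iff_isMinimal hmn)
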